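/- Let $d\ge 1$ and $0<p\le 1$. Fix $\Psi\in\mathcal S(\mathbb R^d)$ with $\int\Psi\ne 0$, put $\Psi_\zeta(x)=\zeta^{-d}\Psi(x/\zeta)$, and for $f\in\mathcal S'(\mathbb R^d)$ let $m_\Psi f(x)=\sup_{\zeta>0}|f*\Psi_\zeta(x)|$ and $\|f\|_{H^p}=\|m_\Psi f\|_{L^p(\mathbb R^d)}$; the real Hardy space $H^p(\mathbb R^d)$ consists of all $f\in\mathcal S'(\mathbb R^d)$ with $\|f\|_{H^p}<\infty$. Let $N\in\mathbb N=\{0,1,2,\dots\}$ be maximal with $N\le d\left(\frac1p-1\right)$. **Proposition (Hardy estimate for sums).** There is a constant $C>0$ depending only on $p$, $d$ and $\Psi$ such that the following holds. Let $J\in\mathbb N$, let $y_1,\dots,y_J\in\mathbb R^d$ and $\varepsilon_1,\dots,\varepsilon_J>0$, and let $f_1,\dots,f_J\in L^\infty(\mathbb R^d)$ vanish almost everywhere outside the balls $B_{\varepsilon_j}(y_j)$ respectively, with $\sum_{j=1}^J f_j\in H^p(\mathbb R^d)$ (the individual $f_j$ need not lie in $H^p$). Let $R>0$ and $y\in\mathbb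 R^d$ be such that $\bigcup_j B_{\varepsilon_j}(y_j)\subset B_R(y)$. Put $$M_j=\max_{|\alpha|\le N}\left|\int_{\mathbb R^d} x^\alpha f_j(x)\,dx\right|,\qquad A=\left(1+\frac{|y|}{\max\{1,R\}}\right)^{N}.$$ Then $$\Big\|\sum_{j=1}^J f_j\Big\|_{H^p}^p\le C\sum_{j=1}^J\Big(\varepsilon_j^d\|f_j\|_{L^\infty}^p+\varepsilon_j^{d-p(d+N)}\max\{R^{Np},1\}\,(A M_j)^p\Big)+C\max\{R^{d-pd},R^{d-p(d+N)}\}\sum_{j=1}^J\Big(1+\log\frac{R}{\varepsilon_j}\Big)(A M_j)^p .$$ If $N<d\left(\frac1p-1\right)$, that is, if $\frac dp\notin\mathbb N$, the same estimate holds with $1+\log\frac{R}{\varepsilon_j}$ replaced by $1$. In particular, if $|y|\le\max\{1,R\}$ (for example $y=0$), then $1\le A^p\le 2^{Np}$, so both estimates hold with $A$ replaced by $1$, with a larger constant depending only on $p$, $d$ and $\Psi$. -/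

import Mathlib

open MeasureTheory SchwartzMap
open scoped ENNReal NNReal

noncomputable section

/-- The Euclidean space `ℝ^d`. -/
abbrev Rd (d : ℕ) : Type := EuclideanSpace ℝ (Fin d)

/-- For `ζ > 0` and `x ∈ ℝ^d`, the Schwartz function `y ↦ Ψ_ζ (x - y)`, where
`Ψ_ζ (z) = ζ^{-d} Ψ (z / ζ)`; see `dilatedKernel_apply`. -/
def dilatedKernel {d : ℕ} (Ψ : 𝓢(Rd d, ℂ)) (ζ : {ζ : ℝ // 0 < ζ}) (x : Rd d) : 𝓢(Rd d, ℂ) :=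
  (((ζ : ℝ) ^ d)⁻¹ : ℝ) •
    SchwartzMap.compSubConstCLM ℂ x
      (SchwartzMap.compCLMOfContinuousLinearEquiv ℂ
        (ContinuousLinearEquiv.smulLeft (M₁ := Rd d) (R₁ := ℝ) (Units.mk0 (-(ζ : ℝ)⁻¹)
            (neg_ne_zero.mpr (inv_ne_zero ζ.2.ne')))) Ψ)

theorem dilatedKernel_apply {d : ℕ} (Ψ : 𝓢(Rd d, ℂ)) (ζ : {ζ : ℝ // 0 < ζ}) (x y : Rd d) :
    dilatedKernel Ψ ζ x y = (((ζ : ℝ) ^ d)⁻¹ : ℝ) • Ψ ((ζ : ℝ)⁻¹ • (x - y)) := by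
  have h : (-(ζ : ℝ)⁻¹) • (y - x) = (ζ : ℝ)⁻¹ • (x - y) := by
    rw [neg_smul, ← smul_neg, neg_sub]
  rw [← h]
  rfl

/-- The convolution `T ∗ Ψ_ζ` of a tempered distribution with `Ψ_ζ`, evaluated at `x`. -/
def convDilated {d : ℕ} (Ψ : 𝓢(Rd d, ℂ)) (T : 𝓢'(Rd d, ℂ)) (ζ : {ζ : ℝ // 0 < ζ})
    (x : Rd d) : ℂ :=
  T (dilatedKernel Ψ ζ x)

/-- The radial maximal function `m_Ψ T (x) = sup_{ζ > 0} |T ∗ Ψ_ζ (x)|`, with values in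
`[0, ∞]`. -/
def radialMaximal {d : ℕ} (Ψ : 𝓢(Rd d, ℂ)) (T : 𝓢'(Rd d, ℂ)) (x : Rd d) : ℝ≥0∞ :=
  ⨆ ζ : {ζ : ℝ // 0 < ζ}, ‖convDilated Ψ T ζ x‖ₑ

/-- The Hardy quasinorm `‖T‖_{H^p} = ‖m_Ψ T‖_{L^p}` (equal to `∞` if `m_Ψ T ∉ L^p`). -/
def hardyNorm {d : ℕ} (Ψ : 𝓢(Rd d, ℂ)) (p : ℝ) (T : 𝓢'(Rd d, ℂ)) : ℝ≥0∞ :=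
  (∫⁻ x, radialMaximal Ψ T x ^ p) ^ (1 / p)

/-- The real Hardy space `H^p(ℝ^d)`. -/
def hardySpace {d : ℕ} (Ψ : 𝓢(Rd d, ℂ)) (p : ℝ) : Set 𝓢'(Rd d, ℂ) :=
  {T | hardyNorm Ψ p T < ∞}

/-- The multi-indices `α ∈ ℕ^d` with `|α| ≤ N`; see `mem_multiIndices`. -/
def multiIndices (d N : ℕ) : Finset (Fin d → ℕ) :=
  (Fintype.piFinset fun _ => Finset.range (N + 1)).filter fun α => ∑ i, α i ≤ N

theorem mem_multiIndices {d N : ℕ} (α : Fin d → ℕ) :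
    α ∈ multiIndices d N ↔ ∑ i, α i ≤ N := by
  simp only [multiIndices, Finset.mem_filter, Fintype.mem_piFinset, Finset.mem_range,
    and_iff_right_iff_imp]
  intro h i
  exact Nat.lt_succ_of_le
    ((Finset.single_le_sum (f := α) (fun _ _ => Nat.zero_le _) (Finset.mem_univ i)).trans h)

/-- The moment `∫ x^α f(x) dx`. -/
def moment {d : ℕ} (f : Rd d → ℂ) (α : Fin d → ℕ) : ℂ :=
  ∫ x, ((∏ i, x i ^ α i : ℝ) : ℂ) * f x

/-- `max_{|α| ≤ N} |∫ x^α f(x) dx|`. -/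
def maxMoment {d : ℕ} (N : ℕ) (f : Rd d → ℂ) : ℝ :=
  ((multiIndices d N).sup fun α => ‖moment f α‖₊ : ℝ≥0)

end

/-!
Write `φ(z) = Ψ_ζ(x - z)`, let `N` be the integer part of `d (1/p - 1)`, and let `T_a φ` be the
Taylor polynomial of `φ` of degree `N` at `a`. Decay of `Ψ` gives `|D^n φ(a)| ≤ K_n |x - a|^{-d-n}`
with `K_n` independent of the scale `ζ` (`norm_iteratedFDeriv_dilatedKernel_mul_le`), so every bound
below passes to the supremum over `ζ`.

The basic identity is that the derivative of `T_a φ(z)` with respect to the base point `a`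
telescopes to the single term `D^{N+1} φ(a)(v, z - a, …, z - a) / N!` (`hasDerivAt_taylorPoly`).
Moving `a` to `z` gives Taylor's theorem. Moving `a` from `y₀` to `y_j` under the integral shows
that `∫ f_j (T_{y_j} φ - T_{y₀} φ)` involves only moments of `f_j` of order at most `N`, with one
additional power of decay (`BoundedOnBall.norm_integral_taylorPoly_sub_le`).

Consequently the contribution of `f_j` at `x` is bounded by `‖f_j‖_∞` when `|x - y_j| ≤ 2 ε_j`; at
larger distances it splits into `∫ f_j (φ - T_{y_j} φ)`, whose decay `|x - y_j|^{-d-N-1}` is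
`p`-integrable at infinity because `N + 1 > d (1/p - 1)`, and `∫ f_j T_{y_j} φ`, which is controlled
by the moments and decays only like `|x - y_j|^{-d-N}`. Integrated over `2 ε_j < |x - y_j| ≤ 4 R`,
the latter produces the logarithm when `p (d + N) = d`, and none otherwise. For `|x - y₀| ≥ 3 R` one
subtracts `∑ ∫ f_j T_{y₀} φ = 0`, so that only the difference of two Taylor polynomials remains
(`exists_radialMaximal_le_sum_majorant`, `exists_lintegral_majorant_rpow_le`).

The sum vanishes because `F = ∑ f_j ∈ H^p` has no moments of order at most `N`
(`moment_eq_zero_of_mem_hardySpace`). If `k ≤ N` were the lowest order of a nonvanishing moment,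
then `F * Ψ_ζ (ζ w) = ± ζ^{-d-k} G(w) / k! + O(ζ^{-d-k-1})` with `G(w) = ∫ D^kΨ(w)(z, …, z) F(z) dz`.
Since `∫ Ψ ≠ 0`, the Fourier transform of `Ψ` does not vanish near the origin, so `G` is not
identically zero, and `|G|` is bounded below on some ball. The dilates of this ball escape to
infinity while each contributes a fixed amount to the integral of `(m_Ψ F)^p`, as `p (d + k) ≤ d`.
-/


/-! ### Taylor polynomials with a moving base point -/

open scoped FourierTransform RealInnerProductSpace in
/-- The iterated derivatives of a Schwartz function are symmetric. By Fourier inversion the function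
is a superposition of characters, for which the symmetry is plain. -/
theorem SchwartzMap.iteratedFDeriv_comp_perm {d : ℕ} (φ : 𝓢(Rd d, ℂ)) (n : ℕ) (x : Rd d)
    (v : Fin n → Rd d) (σ : Equiv.Perm (Fin n)) :
    iteratedFDeriv ℝ n φ x (v ∘ σ) = iteratedFDeriv ℝ n φ x v := by
  set g : 𝓢(Rd d, ℂ) := 𝓕⁻ φ with hg
  have hφ : (φ : Rd d → ℂ) = 𝓕 (g : Rd d → ℂ) := by
    rw [← SchwartzMap.fourier_coe, hg, FourierTransform.fourier_fourierInv_eq]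
  have hsym : ∀ w, (VectorFourier.fourierPowSMulRight (innerSL ℝ) (g : Rd d → ℂ) w n).domDomCongr σ
      = VectorFourier.fourierPowSMulRight (innerSL ℝ) (g : Rd d → ℂ) w n := by
    intro w
    ext m
    simp only [ContinuousMultilinearMap.domDomCongr_apply,
      VectorFourier.fourierPowSMulRight_apply]
    rw [Equiv.prod_comp σ (fun i => innerSL ℝ w (m i))]
  have key : iteratedFDeriv ℝ n φ x
      = 𝓕 (fun w ↦ VectorFourier.fourierPowSMulRight (innerSL ℝ) (g : Rd d → ℂ) w n) x := by
    rw [hφ, Real.iteratedFDeriv_fourier (N := n)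
      (fun m _ => g.integrable_pow_mul volume m) g.continuous.aestronglyMeasurable le_rfl]
  have hT : (iteratedFDeriv ℝ n φ x).domDomCongr σ = iteratedFDeriv ℝ n φ x := by
    rw [key, Real.fourier_eq]
    have := (ContinuousMultilinearMap.domDomCongrₗᵢ ℝ (Rd d) ℂ
      σ).toContinuousLinearEquiv.integral_comp_comm (μ := volume)
      (fun w => 𝐞 (-⟪w, x⟫) • VectorFourier.fourierPowSMulRight (innerSL ℝ) (g : Rd d → ℂ) w n)
    refine this.symm.trans (integral_congr_ae (Filter.Eventually.of_forall fun w => ?_))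
    exact congrArg (fun L => 𝐞 (-⟪w, x⟫) • L) (hsym w)
  exact congrArg (fun L => L v) hT

/-- The Taylor polynomial of degree `N` of `φ` at `a`, evaluated at `z`. -/
noncomputable def taylorPoly {d : ℕ} (N : ℕ) (φ : Rd d → ℂ) (a z : Rd d) : ℂ :=
  ∑ k ∈ Finset.range (N + 1), ((k.factorial : ℝ)⁻¹) • iteratedFDeriv ℝ k φ a (fun _ => z - a)

theorem taylorPoly_self {d : ℕ} (N : ℕ) (φ : Rd d → ℂ) (z : Rd d) : taylorPoly N φ z z = φ z := by
  rw [taylorPoly, Finset.sum_range_succ', Finset.sum_eq_zero]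
  · simp
  · intro k _
    rw [(iteratedFDeriv ℝ (k + 1) φ z).map_coord_zero (0 : Fin (k + 1)) (sub_self z), smul_zero]

theorem iteratedFDeriv_update_const {d : ℕ} (φ : 𝓢(Rd d, ℂ)) (k : ℕ) (a v w : Rd d)
    (i : Fin (k + 1)) :
    iteratedFDeriv ℝ (k + 1) φ a (Function.update (fun _ => w) i v)
      = fderiv ℝ (iteratedFDeriv ℝ k φ) a v (fun _ => w) := by
  have h : (Function.update (fun _ => w) i v : Fin (k + 1) → Rd d)
      = (Fin.cons v (fun _ => w) : Fin (k + 1) → Rd d) ∘ (Equiv.swap 0 i) := by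
    ext1 j
    rcases eq_or_ne j i with rfl | hj
    · simp
    · rcases eq_or_ne j 0 with rfl | h0
      · rw [Function.update_of_ne hj, Function.comp_apply, Equiv.swap_apply_left]
        obtain ⟨l, rfl⟩ := Fin.exists_succ_eq.2 (Ne.symm hj)
        simp
      · rw [Function.update_of_ne hj, Function.comp_apply, Equiv.swap_apply_of_ne_of_ne h0 hj]
        obtain ⟨l, rfl⟩ := Fin.exists_succ_eq.2 h0
        simp
  rw [h, φ.iteratedFDeriv_comp_perm, iteratedFDeriv_succ_apply_left]
  rfl

/-- Differentiating the Taylor polynomial with respect to its base point: the sum telescopes, and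
only the term of highest order survives. -/
theorem hasDerivAt_taylorPoly {d : ℕ} (N : ℕ) (φ : 𝓢(Rd d, ℂ)) (a v z : Rd d) (t : ℝ) :
    HasDerivAt (fun t : ℝ => taylorPoly N φ (a + t • v) z)
      (((N.factorial : ℝ)⁻¹) • fderiv ℝ (iteratedFDeriv ℝ N φ) (a + t • v) v
        (fun _ => z - (a + t • v))) t := by
  have hline : HasDerivAt (fun t : ℝ => a + t • v) v t := by
    simpa using ((hasDerivAt_id t).smul_const v).const_add a
  have hterm : ∀ k : ℕ, HasDerivAt
      (fun t : ℝ => iteratedFDeriv ℝ k φ (a + t • v) (fun _ => z - (a + t • v)))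
      (fderiv ℝ (iteratedFDeriv ℝ k φ) (a + t • v) v (fun _ => z - (a + t • v))
        - ∑ i : Fin k, iteratedFDeriv ℝ k φ (a + t • v)
            (Function.update (fun _ => z - (a + t • v)) i v)) t := by
    intro k
    have hd : HasFDerivAt (iteratedFDeriv ℝ k φ)
        (fderiv ℝ (iteratedFDeriv ℝ k φ) (a + t • v)) (a + t • v) :=
      ((φ.smooth (k + 1)).differentiable_iteratedFDeriv
        (by exact_mod_cast Nat.lt_succ_self k) _).hasFDerivAt
    have hsub : HasFDerivAt (fun b : Rd d => z - b) (-(ContinuousLinearMap.id ℝ (Rd d)))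
        (a + t • v) := (hasFDerivAt_id _).const_sub z
    have := (hd.continuousMultilinearMap_apply (fun _ : Fin k => hsub)).comp_hasDerivAt t hline
    refine this.congr_deriv ?_
    simp [sub_eq_add_neg, Finset.sum_neg_distrib]
  induction N with
  | zero =>
    simpa [taylorPoly] using hterm 0
  | succ N ih =>
    have h2 := ih.add ((hterm (N + 1)).const_smul (((N + 1).factorial : ℝ)⁻¹))
    have e : (fun t : ℝ => taylorPoly (N + 1) φ (a + t • v) z)
        = (fun t : ℝ => taylorPoly N φ (a + t • v) z) + ((((N + 1).factorial : ℝ)⁻¹) • fun t : ℝ =>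
          iteratedFDeriv ℝ (N + 1) φ (a + t • v) (fun _ => z - (a + t • v))) := by
      ext t
      simp [taylorPoly, Finset.sum_range_succ _ (N + 1)]
    rw [e]
    refine h2.congr_deriv ?_
    simp only [iteratedFDeriv_update_const, Finset.sum_const, Finset.card_univ, Fintype.card_fin]
    rw [smul_sub, ← Nat.cast_smul_eq_nsmul ℝ, smul_smul]
    have : (((N + 1).factorial : ℝ)⁻¹) * ((N + 1 : ℕ) : ℝ) = (N.factorial : ℝ)⁻¹ := by
      rw [Nat.factorial_succ]
      push_cast
      field_simp
    rw [this]
    abel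

theorem norm_fderiv_iteratedFDeriv_apply_le {d : ℕ} (N : ℕ) (φ : Rd d → ℂ) (a v : Rd d) :
    ‖fderiv ℝ (iteratedFDeriv ℝ N φ) a v‖ ≤ ‖iteratedFDeriv ℝ (N + 1) φ a‖ * ‖v‖ := by
  rw [← norm_fderiv_iteratedFDeriv]
  exact ContinuousLinearMap.le_opNorm _ _

theorem inv_factorial_le_one (N : ℕ) : ((N.factorial : ℝ)⁻¹) ≤ 1 :=
  inv_le_one_of_one_le₀ (by exact_mod_cast N.factorial_pos)

/-- Taylor's theorem, with the remainder estimated along the segment. -/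
theorem norm_sub_taylorPoly_le {d : ℕ} (N : ℕ) (φ : 𝓢(Rd d, ℂ)) (a z : Rd d) (S : ℝ)
    (hS : ∀ t ∈ Set.Icc (0 : ℝ) 1, ‖iteratedFDeriv ℝ (N + 1) φ (a + t • (z - a))‖ ≤ S) :
    ‖φ z - taylorPoly N φ a z‖ ≤ S * ‖z - a‖ ^ (N + 1) := by
  have h := norm_image_sub_le_of_norm_deriv_le_segment_01'
    (f := fun t : ℝ => taylorPoly N φ (a + t • (z - a)) z) (C := S * ‖z - a‖ ^ (N + 1))
    (fun t _ => (hasDerivAt_taylorPoly N φ a (z - a) z t).hasDerivWithinAt) ?_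
  · simpa [taylorPoly_self] using h
  · intro t ht
    have ht' : t ∈ Set.Icc (0 : ℝ) 1 := ⟨ht.1, ht.2.le⟩
    have hz : ‖z - (a + t • (z - a))‖ ≤ ‖z - a‖ := by
      have : z - (a + t • (z - a)) = (1 - t) • (z - a) := by
        rw [sub_smul, one_smul]; abel
      rw [this, norm_smul, Real.norm_of_nonneg (by linarith [ht.2])]
      exact mul_le_of_le_one_left (norm_nonneg _) (by linarith [ht.1])
    rw [norm_smul, Real.norm_of_nonneg (by positivity)]
    refine (mul_le_of_le_one_left (norm_nonneg _) (inv_factorial_le_one N)).trans ?_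
    refine (ContinuousMultilinearMap.le_opNorm _ _).trans ?_
    have h1 := (norm_fderiv_iteratedFDeriv_apply_le N φ (a + t • (z - a)) (z - a)).trans
      (mul_le_mul_of_nonneg_right (hS t ht') (norm_nonneg _))
    have hS0 : 0 ≤ S := (norm_nonneg _).trans (hS t ht')
    calc _ ≤ (S * ‖z - a‖) * ‖z - a‖ ^ N := by
          simp only [Finset.prod_const, Finset.card_univ, Fintype.card_fin]
          gcongr
      _ = _ := by ring

/-! ### Moments of bounded functions with compact support -/

/-- `f` is measurable, bounded by `B` and supported in the ball `B_ε(a)`, up to null sets. -/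
structure BoundedOnBall {d : ℕ} (f : Rd d → ℂ) (a : Rd d) (ε B : ℝ) : Prop where
  meas : AEStronglyMeasurable f volume
  bound : ∀ᵐ x, ‖f x‖ ≤ B
  supp : ∀ᵐ x, x ∉ Metric.ball a ε → f x = 0

namespace BoundedOnBall

variable {d : ℕ} {f : Rd d → ℂ} {a : Rd d} {ε B : ℝ}

theorem nonneg_bound (hf : BoundedOnBall f a ε B) : 0 ≤ B := by
  obtain ⟨x, hx⟩ := hf.bound.exists
  exact (norm_nonneg _).trans hx

theorem integrable_mul (hf : BoundedOnBall f a ε B) {g : Rd d → ℂ} (hg : Continuous g) :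
    Integrable (fun x => g x * f x) := by
  have h1 : IntegrableOn f (Metric.closedBall a ε) :=
    Measure.integrableOn_of_bounded measure_closedBall_lt_top.ne hf.meas
      (ae_restrict_of_ae hf.bound)
  have h2 : IntegrableOn (fun x => g x * f x) (Metric.closedBall a ε) :=
    h1.continuousOn_mul hg.continuousOn (isCompact_closedBall a ε)
  refine h2.integrable_of_ae_notMem_eq_zero ?_
  filter_upwards [hf.supp] with x hx hxs
  rw [hx fun h => hxs (Metric.ball_subset_closedBall h), mul_zero]

theorem norm_integral_mul_le (hf : BoundedOnBall f a ε B) (hε : 0 < ε) {g : Rd d → ℂ} {S : ℝ}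
    (hS : ∀ z ∈ Metric.ball a ε, ‖g z‖ ≤ S) :
    ‖∫ x, g x * f x‖ ≤ S * B * (volume.real (Metric.ball (0 : Rd d) 1) * ε ^ d) := by
  have h0 : ∀ᵐ x, x ∉ Metric.ball a ε → g x * f x = 0 := by
    filter_upwards [hf.supp] with x hx hxs
    rw [hx hxs, mul_zero]
  rw [← setIntegral_eq_integral_of_ae_compl_eq_zero h0]
  have hvol : volume.real (Metric.ball a ε) = volume.real (Metric.ball (0 : Rd d) 1) * ε ^ d := by
    rw [measureReal_def, Measure.addHaar_ball_of_pos _ _ hε, ENNReal.toReal_mul,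
      ENNReal.toReal_ofReal (by positivity), measureReal_def, finrank_euclideanSpace_fin, mul_comm]
  rw [← hvol]
  refine norm_setIntegral_le_of_norm_le_const_ae' measure_ball_lt_top ?_
  filter_upwards [hf.bound] with x hx hxs
  rw [norm_mul]
  exact mul_le_mul (hS x hxs) hx (norm_nonneg _) ((norm_nonneg _).trans (hS x hxs))

end BoundedOnBall

theorem norm_moment_le_maxMoment {d N : ℕ} (f : Rd d → ℂ) {α : Fin d → ℕ} (hα : ∑ i, α i ≤ N) :
    ‖moment f α‖ ≤ maxMoment N f := by
  have h := Finset.le_sup (f := fun α => ‖moment f α‖₊) ((mem_multiIndices (N := N) α).2 hα)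
  exact_mod_cast h

theorem maxMoment_nonneg {d : ℕ} (N : ℕ) (f : Rd d → ℂ) : 0 ≤ maxMoment N f := NNReal.coe_nonneg _

theorem maxMoment_eq_zero {d N : ℕ} {f : Rd d → ℂ}
    (h : ∀ α : Fin d → ℕ, ∑ i, α i ≤ N → moment f α = 0) : maxMoment N f = 0 := by
  rw [maxMoment, NNReal.coe_eq_zero, ← bot_eq_zero, Finset.sup_eq_bot_iff]
  intro α hα
  rw [h α ((mem_multiIndices α).1 hα)]
  simp

theorem prod_coord_eq_prod_pow {d k : ℕ} (z : Rd d) (i : Fin k → Fin d) (s : Finset (Fin k)) :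
    ∏ l ∈ s, z (i l) = ∏ j, z j ^ (s.filter fun l => i l = j).card := by
  rw [← Finset.prod_fiberwise s i]
  refine Finset.prod_congr rfl fun j _ => ?_
  rw [← Finset.prod_const]
  refine Finset.prod_congr rfl fun l hl => ?_
  rw [(Finset.mem_filter.1 hl).2]

theorem norm_integral_prod_coord_le {d k N : ℕ} (hk : k ≤ N) (f : Rd d → ℂ) (i : Fin k → Fin d)
    (s : Finset (Fin k)) :
    ‖∫ z, ((∏ l ∈ s, z (i l) : ℝ) : ℂ) * f z‖ ≤ maxMoment N f := by
  have hα : ∑ j, (s.filter fun l => i l = j).card ≤ N := by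
    rw [← Finset.card_eq_sum_card_fiberwise (f := i) (t := Finset.univ) (by simp)]
    exact ((Finset.card_le_univ s).trans (by simp)).trans hk
  refine le_trans (le_of_eq ?_) (norm_moment_le_maxMoment f hα)
  simp only [moment, prod_coord_eq_prod_pow]

/-- The moments about `a` are controlled by those about the origin. -/
theorem BoundedOnBall.norm_integral_prod_sub_le {d : ℕ} {f : Rd d → ℂ} {c : Rd d} {ε B : ℝ}
    (hf : BoundedOnBall f c ε B) {k N : ℕ} (hk : k ≤ N) (a : Rd d) (i : Fin k → Fin d) :
    ‖∫ z, ((∏ l, (z - a) (i l) : ℝ) : ℂ) * f z‖ ≤ (1 + ‖a‖) ^ k * maxMoment N f := by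
  have hexp : ∀ z : Rd d, ((∏ l, (z - a) (i l) : ℝ) : ℂ) * f z
      = ∑ s ∈ Finset.univ.powerset, ((∏ l ∈ Finset.univ \ s, -a (i l) : ℝ) : ℂ) *
          (((∏ l ∈ s, z (i l) : ℝ) : ℂ) * f z) := by
    intro z
    have : (∏ l, (z - a) (i l) : ℝ) = ∏ l, (z (i l) + -a (i l)) := by
      simp [sub_eq_add_neg]
    rw [this, Finset.prod_add, Complex.ofReal_sum, Finset.sum_mul]
    refine Finset.sum_congr rfl fun s _ => ?_
    push_cast
    ring
  simp_rw [hexp]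
  rw [integral_finsetSum _ fun s _ => (hf.integrable_mul (by fun_prop)).const_mul _]
  simp_rw [integral_const_mul]
  have hM := maxMoment_nonneg N f
  calc _ ≤ ∑ s ∈ (Finset.univ : Finset (Fin k)).powerset,
        (∏ l ∈ Finset.univ \ s, ‖a‖) * maxMoment N f := by
        refine norm_sum_le_of_le _ fun s _ => ?_
        rw [norm_mul]
        refine mul_le_mul ?_ (norm_integral_prod_coord_le hk f i s) (norm_nonneg _) (by positivity)
        rw [Complex.norm_real, norm_prod]
        refine Finset.prod_le_prod (fun _ _ => norm_nonneg _) fun l _ => ?_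
        rw [norm_neg]
        exact PiLp.norm_apply_le a (i l)
    _ = (1 + ‖a‖) ^ k * maxMoment N f := by
        rw [← Finset.sum_mul]
        congr 1
        have := Finset.prod_add (fun _ : Fin k => (1 : ℝ)) (fun _ => ‖a‖) Finset.univ
        simp only [Finset.prod_const_one, one_mul] at this
        rw [← this]
        simp

theorem ContinuousMultilinearMap.apply_const_eq_sum {d k : ℕ} (L : (Rd d) [×k]→L[ℝ] ℂ) (w : Rd d) :
    L (fun _ => w) = ∑ i : Fin k → Fin d,
      ((∏ l, w (i l) : ℝ) : ℂ) * L fun l => EuclideanSpace.single (i l) (1 : ℝ) := by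
  have hw : w = ∑ j, w j • EuclideanSpace.single j (1 : ℝ) := by
    ext j
    simp [Finset.sum_apply, Pi.single_apply]
  conv_lhs => rw [hw]
  rw [L.map_sum]
  refine Finset.sum_congr rfl fun i _ => ?_
  rw [L.map_smul_univ, Complex.real_smul]

/-- Integration against a homogeneous polynomial of degree `k` centred at `a`. -/
theorem BoundedOnBall.norm_integral_multilinear_le {d : ℕ} {f : Rd d → ℂ} {c : Rd d} {ε B : ℝ}
    (hf : BoundedOnBall f c ε B) {k N : ℕ} (hk : k ≤ N) (a : Rd d) (L : (Rd d) [×k]→L[ℝ] ℂ) :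
    ‖∫ z, L (fun _ => z - a) * f z‖ ≤ d ^ k * (1 + ‖a‖) ^ k * ‖L‖ * maxMoment N f := by
  have hexp : ∀ z : Rd d, L (fun _ => z - a) * f z = ∑ i : Fin k → Fin d,
      L (fun l => EuclideanSpace.single (i l) (1 : ℝ)) *
        (((∏ l, (z - a) (i l) : ℝ) : ℂ) * f z) := by
    intro z
    rw [L.apply_const_eq_sum, Finset.sum_mul]
    exact Finset.sum_congr rfl fun i _ => by ring
  simp_rw [hexp]
  rw [integral_finsetSum _ fun s _ => (hf.integrable_mul (by fun_prop)).const_mul _]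
  simp_rw [integral_const_mul]
  calc _ ≤ ∑ _i : Fin k → Fin d, ‖L‖ * ((1 + ‖a‖) ^ k * maxMoment N f) := by
        refine norm_sum_le_of_le _ fun i _ => ?_
        rw [norm_mul]
        refine mul_le_mul ?_ (hf.norm_integral_prod_sub_le hk a i) (norm_nonneg _) (norm_nonneg _)
        simpa using L.le_opNorm fun l => EuclideanSpace.single (i l) (1 : ℝ)
    _ = _ := by
        simp
        ring

theorem continuous_apply_const_sub {d k : ℕ} (L : (Rd d) [×k]→L[ℝ] ℂ) (a : Rd d) :
    Continuous fun z : Rd d => L (fun _ => z - a) :=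
  L.cont.comp (by fun_prop)

theorem continuous_taylorPoly {d : ℕ} (N : ℕ) (φ : Rd d → ℂ) (a : Rd d) :
    Continuous fun z => taylorPoly N φ a z :=
  continuous_finsetSum _ fun k _ =>
    (continuous_apply_const_sub (iteratedFDeriv ℝ k φ a) a).fun_const_smul _

theorem BoundedOnBall.integral_taylorPoly {d : ℕ} {f : Rd d → ℂ} {c : Rd d} {ε B : ℝ}
    (hf : BoundedOnBall f c ε B) (N : ℕ) (φ : Rd d → ℂ) (a : Rd d) :
    ∫ z, taylorPoly N φ a z * f z = ∑ k ∈ Finset.range (N + 1),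
      ((k.factorial : ℝ)⁻¹) • ∫ z, iteratedFDeriv ℝ k φ a (fun _ => z - a) * f z := by
  simp_rw [taylorPoly, Finset.sum_mul, smul_mul_assoc]
  rw [integral_finsetSum _ fun k _ => (hf.integrable_mul
    (continuous_apply_const_sub (iteratedFDeriv ℝ k φ a) a)).fun_smul _]
  simp_rw [integral_smul]

theorem BoundedOnBall.norm_integral_taylorPoly_le {d : ℕ} {f : Rd d → ℂ} {c : Rd d} {ε B : ℝ}
    (hf : BoundedOnBall f c ε B) (N : ℕ) (φ : Rd d → ℂ) (a : Rd d) :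
    ‖∫ z, taylorPoly N φ a z * f z‖ ≤ ∑ k ∈ Finset.range (N + 1),
      d ^ k * (1 + ‖a‖) ^ k * ‖iteratedFDeriv ℝ k φ a‖ * maxMoment N f := by
  rw [hf.integral_taylorPoly]
  refine norm_sum_le_of_le _ fun k hk => ?_
  rw [norm_smul, Real.norm_of_nonneg (by positivity)]
  exact (mul_le_of_le_one_left (norm_nonneg _) (inv_factorial_le_one k)).trans
    (hf.norm_integral_multilinear_le (Nat.lt_succ_iff.1 (Finset.mem_range.1 hk)) a _)

theorem BoundedOnBall.hasDerivAt_integral_taylorPoly {d : ℕ} {f : Rd d → ℂ} {c : Rd d} {ε B : ℝ}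
    (hf : BoundedOnBall f c ε B) (N : ℕ) (φ : 𝓢(Rd d, ℂ)) (a v : Rd d) (t : ℝ) :
    HasDerivAt (fun t : ℝ => ∫ z, taylorPoly N φ (a + t • v) z * f z)
      (∫ z, (((N.factorial : ℝ)⁻¹) • fderiv ℝ (iteratedFDeriv ℝ N φ) (a + t • v) v
        (fun _ => z - (a + t • v))) * f z) t := by
  obtain ⟨K, hK⟩ : ∃ K : ℝ, ∀ x, ‖iteratedFDeriv ℝ (N + 1) φ x‖ ≤ K :=
    ⟨SchwartzMap.seminorm ℝ 0 (N + 1) φ, fun x => by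
      simpa using φ.le_seminorm ℝ 0 (N + 1) x⟩
  have hK0 : 0 ≤ K := (norm_nonneg _).trans (hK 0)
  have hbound : ∀ z, ∀ s ∈ Metric.ball t 1,
      ‖((N.factorial : ℝ)⁻¹) • fderiv ℝ (iteratedFDeriv ℝ N φ) (a + s • v) v
        (fun _ => z - (a + s • v))‖ ≤ K * ‖v‖ * (‖z‖ + (‖a‖ + (|t| + 1) * ‖v‖)) ^ N := by
    intro z s hs
    rw [norm_smul, Real.norm_of_nonneg (by positivity)]
    refine (mul_le_of_le_one_left (norm_nonneg _) (inv_factorial_le_one N)).trans ?_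
    refine (ContinuousMultilinearMap.le_opNorm _ _).trans ?_
    simp only [Finset.prod_const, Finset.card_univ, Fintype.card_fin]
    have hst : |s| ≤ |t| + 1 := by
      have h1 : |s - t| < 1 := by simpa [Real.dist_eq] using hs
      have h2 := abs_sub_abs_le_abs_sub s t
      linarith
    have h3 : ‖z - (a + s • v)‖ ≤ ‖z‖ + (‖a‖ + (|t| + 1) * ‖v‖) := by
      refine (norm_sub_le _ _).trans (add_le_add_right ((norm_add_le _ _).trans ?_) _)
      rw [norm_smul, Real.norm_eq_abs]
      gcongr
    have h4 := (norm_fderiv_iteratedFDeriv_apply_le N φ (a + s • v) v).trans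
      (mul_le_mul_of_nonneg_right (hK _) (norm_nonneg _))
    exact mul_le_mul h4 (pow_le_pow_left₀ (norm_nonneg _) h3 N) (by positivity) (by positivity)
  have hint : Integrable
      (fun z => ((K * ‖v‖ * (‖z‖ + (‖a‖ + (|t| + 1) * ‖v‖)) ^ N : ℝ) : ℂ) * f z) :=
    hf.integrable_mul (by fun_prop)
  have hint0 : ∀ s : ℝ, Integrable (fun z => taylorPoly N φ (a + s • v) z * f z) := fun s =>
    hf.integrable_mul (continuous_taylorPoly N φ _)
  refine (hasDerivAt_integral_of_dominated_loc_of_deriv_le (Metric.ball_mem_nhds t one_pos)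
    (F' := fun s z => (((N.factorial : ℝ)⁻¹) • fderiv ℝ (iteratedFDeriv ℝ N φ) (a + s • v) v
        (fun _ => z - (a + s • v))) * f z)
    (Filter.Eventually.of_forall fun s => (hint0 s).aestronglyMeasurable) (hint0 t)
    (hf.integrable_mul ((continuous_apply_const_sub
      (fderiv ℝ (iteratedFDeriv ℝ N φ) (a + t • v) v) _).fun_const_smul _)).aestronglyMeasurable
    (Filter.Eventually.of_forall fun z s hs => ?_) hint.norm
    (Filter.Eventually.of_forall fun z s _ =>
      (hasDerivAt_taylorPoly N φ a v z s).mul_const (f z))).2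
  rw [norm_mul, norm_mul, Complex.norm_real]
  exact mul_le_mul_of_nonneg_right ((hbound z s hs).trans (Real.le_norm_self _)) (norm_nonneg _)

/-- Moving the base point of the Taylor polynomial from `a` to `b` costs only one derivative of
order `N + 1`, integrated against moments of order at most `N`. -/
theorem BoundedOnBall.norm_integral_taylorPoly_sub_le {d : ℕ} {f : Rd d → ℂ} {c : Rd d} {ε B : ℝ}
    (hf : BoundedOnBall f c ε B) (N : ℕ) (φ : 𝓢(Rd d, ℂ)) (a b : Rd d) (S ρ : ℝ)
    (hS : ∀ t ∈ Set.Icc (0 : ℝ) 1, ‖iteratedFDeriv ℝ (N + 1) φ (a + t • (b - a))‖ ≤ S)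
    (hρ : ∀ t ∈ Set.Icc (0 : ℝ) 1, ‖a + t • (b - a)‖ ≤ ρ) :
    ‖(∫ z, taylorPoly N φ b z * f z) - ∫ z, taylorPoly N φ a z * f z‖
      ≤ d ^ N * (1 + ρ) ^ N * (S * ‖b - a‖) * maxMoment N f := by
  have h := norm_image_sub_le_of_norm_deriv_le_segment_01'
    (f := fun t : ℝ => ∫ z, taylorPoly N φ (a + t • (b - a)) z * f z)
    (C := d ^ N * (1 + ρ) ^ N * (S * ‖b - a‖) * maxMoment N f)
    (fun t _ => (hf.hasDerivAt_integral_taylorPoly N φ a (b - a) t).hasDerivWithinAt) ?_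
  · simpa using h
  · intro t ht
    have ht' : t ∈ Set.Icc (0 : ℝ) 1 := ⟨ht.1, ht.2.le⟩
    simp_rw [smul_mul_assoc]
    rw [integral_smul, norm_smul, Real.norm_of_nonneg (by positivity)]
    refine (mul_le_of_le_one_left (norm_nonneg _) (inv_factorial_le_one N)).trans ?_
    refine (hf.norm_integral_multilinear_le le_rfl _ _).trans ?_
    have hM := maxMoment_nonneg N f
    have h1 := (norm_fderiv_iteratedFDeriv_apply_le N φ (a + t • (b - a)) (b - a)).trans
      (mul_le_mul_of_nonneg_right (hS t ht') (norm_nonneg _))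
    have h2 := hρ t ht'
    have hρ0 : 0 ≤ ρ := (norm_nonneg _).trans h2
    gcongr

/-! ### Dilated kernels and radial integrals -/

theorem iteratedFDeriv_dilatedKernel {d : ℕ} (Ψ : 𝓢(Rd d, ℂ)) (ζ : {ζ : ℝ // 0 < ζ}) (x a : Rd d)
    (n : ℕ) : iteratedFDeriv ℝ n (dilatedKernel Ψ ζ x) a
      = ((((ζ : ℝ) ^ d)⁻¹) * (-(ζ : ℝ)⁻¹) ^ n) • iteratedFDeriv ℝ n Ψ ((ζ : ℝ)⁻¹ • (x - a)) := by
  have h1 : (dilatedKernel Ψ ζ x : Rd d → ℂ) = fun y => (((ζ : ℝ) ^ d)⁻¹) •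
      ((Ψ : Rd d → ℂ) ∘ ((-(ζ : ℝ)⁻¹) • ContinuousLinearMap.id ℝ (Rd d))) (y - x) := by
    ext y
    rw [dilatedKernel_apply]
    simp [← smul_neg]
  have hc : ContDiff ℝ n ((Ψ : Rd d → ℂ) ∘ ((-(ζ : ℝ)⁻¹) • ContinuousLinearMap.id ℝ (Rd d))) :=
    (Ψ.smooth n).comp (ContinuousLinearMap.contDiff _)
  rw [h1, iteratedFDeriv_const_smul_apply' (f := fun y =>
    ((Ψ : Rd d → ℂ) ∘ ((-(ζ : ℝ)⁻¹) • ContinuousLinearMap.id ℝ (Rd d))) (y - x))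
    (hc.comp (contDiff_id.sub contDiff_const)).contDiffAt,
    iteratedFDeriv_comp_sub, ContinuousLinearMap.iteratedFDeriv_comp_right _ (Ψ.smooth n) _ le_rfl]
  ext m
  simp only [smul_apply,
    ContinuousMultilinearMap.compContinuousLinearMap_apply,
    ContinuousLinearMap.id_apply, mul_smul]
  rw [ContinuousMultilinearMap.map_smul_univ]
  simp [← smul_neg]

theorem norm_iteratedFDeriv_dilatedKernel {d : ℕ} (Ψ : 𝓢(Rd d, ℂ)) (ζ : {ζ : ℝ // 0 < ζ})
    (x a : Rd d) (n : ℕ) : ‖iteratedFDeriv ℝ n (dilatedKernel Ψ ζ x) a‖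
      = ((ζ : ℝ) ^ (d + n))⁻¹ * ‖iteratedFDeriv ℝ n Ψ ((ζ : ℝ)⁻¹ • (x - a))‖ := by
  have hζ := ζ.2
  rw [iteratedFDeriv_dilatedKernel, norm_smul, norm_mul, norm_pow, norm_neg,
    Real.norm_of_nonneg (by positivity), Real.norm_of_nonneg (by positivity), pow_add, mul_inv,
    inv_pow]

/-- The decay of the derivatives of `Ψ` turns into a bound that is uniform in the scale `ζ`. -/
theorem norm_iteratedFDeriv_dilatedKernel_mul_le {d : ℕ} (Ψ : 𝓢(Rd d, ℂ)) (ζ : {ζ : ℝ // 0 < ζ})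
    (x a : Rd d) (n : ℕ) : ‖iteratedFDeriv ℝ n (dilatedKernel Ψ ζ x) a‖ * ‖x - a‖ ^ (d + n)
      ≤ SchwartzMap.seminorm ℝ (d + n) n Ψ := by
  have hζ := ζ.2
  refine le_trans (le_of_eq ?_) (Ψ.le_seminorm ℝ (d + n) n ((ζ : ℝ)⁻¹ • (x - a)))
  rw [norm_iteratedFDeriv_dilatedKernel, norm_smul, Real.norm_of_nonneg (by positivity), mul_pow,
    inv_pow]
  ring

theorem integral_norm_dilatedKernel {d : ℕ} (Ψ : 𝓢(Rd d, ℂ)) (ζ : {ζ : ℝ // 0 < ζ}) (x : Rd d) :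
    ∫ y, ‖dilatedKernel Ψ ζ x y‖ = ∫ y, ‖Ψ y‖ := by
  have hζ := ζ.2
  simp_rw [dilatedKernel_apply, norm_smul]
  rw [integral_const_mul, integral_sub_left_eq_self (fun y => ‖Ψ ((ζ : ℝ)⁻¹ • y)‖),
    Measure.integral_comp_inv_smul_of_nonneg volume (fun y => ‖Ψ y‖) hζ.le,
    finrank_euclideanSpace_fin, Real.norm_of_nonneg (by positivity), smul_eq_mul, ← mul_assoc,
    inv_mul_cancel₀ (by positivity), one_mul]

/-- Integration of a power of the distance to `a` over a spherical shell, in polar coordinates. -/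
theorem lintegral_indicator_norm_rpow {d : ℕ} (hd : 1 ≤ d) (a : Rd d) {S : Set ℝ}
    (hS : MeasurableSet S) (hS0 : S ⊆ Set.Ioi 0) (q : ℝ)
    (hint : IntegrableOn (fun y : ℝ => y ^ ((d : ℝ) - 1 - q)) S) :
    ∫⁻ x : Rd d, S.indicator (fun s => ENNReal.ofReal (s ^ (-q))) ‖x - a‖
      = ENNReal.ofReal (d * volume.real (Metric.ball (0 : Rd d) 1)
          * ∫ y in S, y ^ ((d : ℝ) - 1 - q)) := by
  have : Nontrivial (Rd d) :=
    Module.nontrivial_of_finrank_pos (R := ℝ) (by rw [finrank_euclideanSpace_fin]; omega)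
  rw [lintegral_sub_right_eq_self
    (fun x : Rd d => S.indicator (fun s => ENNReal.ofReal (s ^ (-q))) ‖x‖)]
  set g : ℝ → ℝ := S.indicator fun s => s ^ (-q) with hg
  have hg0 : ∀ s, 0 ≤ g s := fun s =>
    Set.indicator_nonneg (fun s hs => Real.rpow_nonneg (le_of_lt (hS0 hs)) _) s
  have hgo : ∀ x : Rd d, S.indicator (fun s => ENNReal.ofReal (s ^ (-q))) ‖x‖
      = ENNReal.ofReal (g ‖x‖) := by
    intro x
    by_cases hx : ‖x‖ ∈ S <;> simp [hg, hx]
  have hrad : Set.EqOn (fun y : ℝ => y ^ (d - 1) • g y)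
      (S.indicator fun y => y ^ ((d : ℝ) - 1 - q)) (Set.Ioi 0) := by
    intro y hy
    by_cases hyS : y ∈ S
    · simp only [hg, Set.indicator_of_mem hyS, smul_eq_mul]
      rw [← Real.rpow_natCast, ← Real.rpow_add hy, Nat.cast_sub hd]
      congr 1
      push_cast
      ring
    · simp [hg, hyS]
  have hintg : Integrable (fun x : Rd d => g ‖x‖) := by
    rw [integrable_fun_norm_addHaar, finrank_euclideanSpace_fin,
      integrableOn_congr_fun hrad measurableSet_Ioi]
    exact ((integrable_indicator_iff hS).2 hint).integrableOn
  simp_rw [hgo]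
  rw [← ofReal_integral_eq_lintegral_ofReal hintg (Filter.Eventually.of_forall fun x => hg0 _),
    integral_fun_norm_addHaar, finrank_euclideanSpace_fin,
    setIntegral_congr_fun measurableSet_Ioi hrad, setIntegral_indicator hS,
    Set.inter_eq_self_of_subset_right hS0]
  simp [mul_assoc]

theorem exists_lintegral_norm_rpow_tail_le {d : ℕ} (hd : 1 ≤ d) {q : ℝ} (hq : d < q) :
    ∃ C : ℝ, 0 < C ∧ ∀ (a : Rd d) (r : ℝ), 0 < r →
      ∫⁻ x : Rd d, (Set.Ioi r).indicator (fun s => ENNReal.ofReal (s ^ (-q))) ‖x - a‖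
        ≤ ENNReal.ofReal (C * r ^ (d - q)) := by
  have hv : 0 < volume.real (Metric.ball (0 : Rd d) 1) :=
    ENNReal.toReal_pos (Metric.measure_ball_pos _ _ one_pos).ne' measure_ball_lt_top.ne
  refine ⟨d * volume.real (Metric.ball (0 : Rd d) 1) / (q - d), ?_, fun a r hr => ?_⟩
  · have : (0 : ℝ) < d := by exact_mod_cast hd
    have : 0 < q - d := by linarith
    positivity
  · have hlt : (d : ℝ) - 1 - q < -1 := by linarith
    rw [lintegral_indicator_norm_rpow hd a measurableSet_Ioi
      (Set.Ioi_subset_Ioi hr.le) q (integrableOn_Ioi_rpow_of_lt hlt hr),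
      integral_Ioi_rpow_of_lt hlt hr]
    refine ENNReal.ofReal_le_ofReal (le_of_eq ?_)
    have e : (d : ℝ) - 1 - q + 1 = d - q := by ring
    have h1 : q - d ≠ 0 := by linarith
    have h2 : (d : ℝ) - q ≠ 0 := by linarith
    rw [e]
    field_simp
    ring

theorem exists_lintegral_norm_rpow_ball_le {d : ℕ} (hd : 1 ≤ d) {q : ℝ} (hq : q < d) :
    ∃ C : ℝ, 0 < C ∧ ∀ (a : Rd d) (s : ℝ), 0 < s →
      ∫⁻ x : Rd d, (Set.Ioc 0 s).indicator (fun s => ENNReal.ofReal (s ^ (-q))) ‖x - a‖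
        ≤ ENNReal.ofReal (C * s ^ (d - q)) := by
  have hv : 0 < volume.real (Metric.ball (0 : Rd d) 1) :=
    ENNReal.toReal_pos (Metric.measure_ball_pos _ _ one_pos).ne' measure_ball_lt_top.ne
  refine ⟨d * volume.real (Metric.ball (0 : Rd d) 1) / (d - q), ?_, fun a s hs => ?_⟩
  · have : (0 : ℝ) < d := by exact_mod_cast hd
    have : 0 < d - q := by linarith
    positivity
  · have hlt : -1 < (d : ℝ) - 1 - q := by linarith
    rw [lintegral_indicator_norm_rpow hd a measurableSet_Ioc
      (fun y hy => hy.1) q ((intervalIntegral.intervalIntegrable_rpow' hlt).1),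
      ← intervalIntegral.integral_of_le hs.le, integral_rpow (Or.inl hlt)]
    refine ENNReal.ofReal_le_ofReal (le_of_eq ?_)
    have e : (d : ℝ) - 1 - q + 1 = d - q := by ring
    have h2 : (d : ℝ) - q ≠ 0 := by linarith
    rw [e, Real.zero_rpow h2]
    field_simp
    ring

theorem exists_lintegral_norm_rpow_annulus_le {d : ℕ} (hd : 1 ≤ d) :
    ∃ C : ℝ, 0 < C ∧ ∀ (a : Rd d) (r s : ℝ), 0 < r → r ≤ s →
      ∫⁻ x : Rd d, (Set.Ioc r s).indicator (fun s => ENNReal.ofReal (s ^ (-(d : ℝ)))) ‖x - a‖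
        ≤ ENNReal.ofReal (C * Real.log (s / r)) := by
  have hv : 0 < volume.real (Metric.ball (0 : Rd d) 1) :=
    ENNReal.toReal_pos (Metric.measure_ball_pos _ _ one_pos).ne' measure_ball_lt_top.ne
  refine ⟨d * volume.real (Metric.ball (0 : Rd d) 1), ?_, fun a r s hr hrs => ?_⟩
  · have : (0 : ℝ) < d := by exact_mod_cast hd
    positivity
  · have e : (d : ℝ) - 1 - d = -1 := by ring
    have h0 : (0 : ℝ) ∉ Set.uIcc r s := by
      rw [Set.uIcc_of_le hrs]; exact fun h => absurd h.1 (not_le.2 hr)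
    rw [lintegral_indicator_norm_rpow hd a measurableSet_Ioc
      (fun y hy => hr.trans hy.1) d, e, ← intervalIntegral.integral_of_le hrs]
    · simp_rw [Real.rpow_neg_one]
      rw [integral_inv h0]
    · rw [e]
      simp_rw [Real.rpow_neg_one]
      exact (intervalIntegral.intervalIntegrable_inv (fun y hy h => h0 (h ▸ hy))
        continuousOn_id).1

/-! ### Symbols of homogeneous differential operators -/

/-- The multilinear form `(v₁, …, v_k) ↦ ∑ᵢ μᵢ ∏ₗ (v_l)_{i l}` with coefficients `μ`. -/
noncomputable def coeffForm {d k : ℕ} (μ : (Fin k → Fin d) → ℂ) : (Rd d) [×k]→L[ℝ] ℂ :=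
  ∑ i, μ i • (ContinuousMultilinearMap.mkPiAlgebra ℝ (Fin k) ℂ).compContinuousLinearMap
    fun l => Complex.ofRealCLM ∘L (EuclideanSpace.proj (i l) : Rd d →L[ℝ] ℝ)

theorem coeffForm_apply {d k : ℕ} (μ : (Fin k → Fin d) → ℂ) (v : Fin k → Rd d) :
    coeffForm μ v = ∑ i, μ i * ∏ l, ((v l (i l) : ℝ) : ℂ) := by
  simp [coeffForm]

/-- A symmetric form that vanishes on the diagonal near the origin has vanishing coefficients. -/
theorem coeff_eq_zero_of_coeffForm_eventually_eq_zero {d k : ℕ} (μ : (Fin k → Fin d) → ℂ)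
    (hμ : ∀ (σ : Equiv.Perm (Fin k)) i, μ (i ∘ σ) = μ i)
    (h0 : ∀ᶠ ξ in nhds (0 : Rd d), coeffForm μ (fun _ => ξ) = 0) (i : Fin k → Fin d) :
    μ i = 0 := by
  set e : Fin k → Rd d := fun l => EuclideanSpace.single (i l) (1 : ℝ) with he
  have hsym : ∀ σ : Equiv.Perm (Fin k), coeffForm μ (fun l => e (σ l)) = coeffForm μ e := by
    intro σ
    rw [coeffForm_apply, coeffForm_apply]
    rw [← Equiv.sum_comp (Equiv.arrowCongr σ.symm (Equiv.refl (Fin d)))]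
    refine Finset.sum_congr rfl fun j _ => ?_
    have h1 : (Equiv.arrowCongr σ.symm (Equiv.refl (Fin d))) j = j ∘ σ := by
      ext l
      simp [Equiv.arrowCongr]
    rw [h1, hμ]
    congr 1
    exact Equiv.prod_comp σ (fun l => ((e l (j l) : ℝ) : ℂ))
  have hval : coeffForm μ e = μ i := by
    rw [coeffForm_apply, Finset.sum_eq_single i]
    · simp [he]
    · intro j _ hj
      obtain ⟨l, hl⟩ := Function.ne_iff.1 hj
      rw [Finset.prod_eq_zero (Finset.mem_univ l), mul_zero]
      simp [he, hl]
    · simp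
  -- By symmetry the `k`-th derivative of the diagonal restriction is `k!` times the form.
  have hz : (fun ξ : Rd d => coeffForm μ (fun _ => ξ)) =ᶠ[nhds 0] fun _ => 0 := h0
  have h := congrArg (fun L => L e) (hz.iteratedFDeriv ℝ k).self_of_nhds
  have hd := ContinuousMultilinearMap.iteratedFDeriv_comp_diagonal (coeffForm μ) 0 e
  simp only [hsym, Finset.sum_const, hval, Finset.card_univ, Fintype.card_perm,
    Fintype.card_fin] at hd
  rw [hd] at h
  have hzero : iteratedFDeriv ℝ k (fun _ : Rd d => (0 : ℂ)) 0 = 0 := by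
    simp
  rw [hzero] at h
  simpa [Nat.factorial_ne_zero] using h

open scoped FourierTransform RealInnerProductSpace in
/-- If a homogeneous constant coefficient operator `∑ᵢ μᵢ ∂_{i 1} ⋯ ∂_{i k}` with symmetric
coefficients annihilates a Schwartz function with nonzero integral, then it is zero: its symbol
vanishes wherever the Fourier transform of the function does not, in particular near the origin. -/
theorem coeff_eq_zero_of_forall_sum_iteratedFDeriv_eq_zero {d k : ℕ} (Ψ : 𝓢(Rd d, ℂ))
    (hΨ : ∫ x, Ψ x ≠ 0) (μ : (Fin k → Fin d) → ℂ)
    (hμ : ∀ (σ : Equiv.Perm (Fin k)) i, μ (i ∘ σ) = μ i)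
    (hG : ∀ w, ∑ i, μ i * iteratedFDeriv ℝ k Ψ w
      (fun l => EuclideanSpace.single (i l) (1 : ℝ)) = 0) (i : Fin k → Fin d) : μ i = 0 := by
  refine coeff_eq_zero_of_coeffForm_eventually_eq_zero μ hμ ?_ i
  have hint : ∀ n : ℕ, (n : ℕ∞) ≤ (k : ℕ∞) → Integrable (iteratedFDeriv ℝ n Ψ) := fun n _ => by
    have h := Ψ.integrable_pow_mul_iteratedFDeriv volume 0 n
    simp only [pow_zero, one_mul] at h
    exact (integrable_norm_iff (Ψ.smooth n).continuous_iteratedFDeriv'.aestronglyMeasurable).1 h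
  have hF := Real.fourier_iteratedFDeriv (N := k) (Ψ.smooth k) hint le_rfl
  have hsum : ∀ ξ, ∑ i, μ i * (𝓕 (iteratedFDeriv ℝ k Ψ) ξ
      (fun l => EuclideanSpace.single (i l) (1 : ℝ))) = 0 := by
    intro ξ
    simp_rw [Real.fourier_continuousMultilinearMap_apply (hint k le_rfl), Real.fourier_eq]
    simp_rw [← integral_const_mul]
    rw [← integral_finsetSum]
    · rw [← integral_zero (Rd d) ℂ]
      refine integral_congr_ae (Filter.Eventually.of_forall fun w => ?_)
      simp only
      rw [← smul_zero (𝐞 (-⟪w, ξ⟫)), ← hG w, Finset.smul_sum]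
      refine Finset.sum_congr rfl fun i _ => ?_
      rw [mul_smul_comm]
    · intro i _
      have h1 : Integrable fun w => iteratedFDeriv ℝ k Ψ w
          (fun l => EuclideanSpace.single (i l) (1 : ℝ)) :=
        (ContinuousMultilinearMap.apply ℝ (fun _ : Fin k => Rd d) ℂ
          (fun l => EuclideanSpace.single (i l) (1 : ℝ))).integrable_comp (hint k le_rfl)
      exact ((Real.fourierIntegral_convergent_iff ξ).2 h1).const_mul _
  have hne : ∀ᶠ ξ in nhds (0 : Rd d), 𝓕 (Ψ : Rd d → ℂ) ξ ≠ 0 := by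
    have hc : Continuous (𝓕 (Ψ : Rd d → ℂ)) := by
      rw [← SchwartzMap.fourier_coe]
      exact (𝓕 Ψ).continuous
    refine hc.continuousAt.eventually_ne ?_
    rw [Real.fourier_eq]
    simpa using hΨ
  filter_upwards [hne] with ξ hξ
  have h := hsum ξ
  rw [hF] at h
  simp only [VectorFourier.fourierPowSMulRight_apply] at h
  have h2 : (2 * Real.pi * Complex.I) ^ k * 𝓕 (Ψ : Rd d → ℂ) ξ * coeffForm μ (fun _ => ξ) = 0 := by
    rw [← h, coeffForm_apply, Finset.mul_sum]
    refine Finset.sum_congr rfl fun i _ => ?_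
    have h3 : ∏ l, ((-innerSL ℝ) ξ) (EuclideanSpace.single (i l) (1 : ℝ))
        = (-1) ^ k * ∏ l, ξ (i l) := by
      simp [Finset.prod_neg, EuclideanSpace.inner_single_right]
    have h4 : ((-1 : ℂ) ^ k) * (-1) ^ k = 1 := by rw [← mul_pow]; simp
    rw [h3, smul_eq_mul, Complex.real_smul, neg_pow (2 * Real.pi * Complex.I)]
    push_cast
    linear_combination (-(2 * Real.pi * Complex.I) ^ k * 𝓕 (Ψ : Rd d → ℂ) ξ
      * (μ i * ∏ l, ((ξ (i l) : ℝ) : ℂ))) * h4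
  refine (mul_eq_zero.1 h2).resolve_left (mul_ne_zero (pow_ne_zero _ ?_) hξ)
  simp [Real.pi_ne_zero]

theorem BoundedOnBall.integral_multilinear_eq_sum {d : ℕ} {f : Rd d → ℂ} {c : Rd d} {ε B : ℝ}
    (hf : BoundedOnBall f c ε B) {k : ℕ} (L : (Rd d) [×k]→L[ℝ] ℂ) :
    ∫ z, L (fun _ => z) * f z = ∑ i : Fin k → Fin d, (∫ z, ((∏ l, z (i l) : ℝ) : ℂ) * f z) *
      L (fun l => EuclideanSpace.single (i l) (1 : ℝ)) := by
  simp_rw [← integral_mul_const]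
  rw [← integral_finsetSum _ fun i _ => (hf.integrable_mul (by fun_prop)).mul_const _]
  refine integral_congr_ae (Filter.Eventually.of_forall fun z => ?_)
  simp only
  rw [L.apply_const_eq_sum, Finset.sum_mul]
  exact Finset.sum_congr rfl fun i _ => by ring

theorem exists_prod_coord_eq {d : ℕ} (α : Fin d → ℕ) :
    ∃ i : Fin (∑ j, α j) → Fin d, ∀ z : Rd d, ∏ l, z (i l) = ∏ j, z j ^ α j := by
  let e := finSigmaFinEquiv (n := α)
  refine ⟨fun l => (e.symm l).1, fun z => ?_⟩
  rw [Equiv.prod_comp e.symm (fun s => z s.1), Fintype.prod_sigma]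
  simp

/-- If `f` has a nonzero moment of order `k`, then `∫ D^kΨ(w)(z, …, z) f(z) dz`, the leading term
of the expansion of `f * Ψ_ζ` at large scales, is not identically zero. -/
theorem BoundedOnBall.exists_integral_iteratedFDeriv_ne_zero {d : ℕ} {f : Rd d → ℂ} {c : Rd d}
    {ε B : ℝ} (hf : BoundedOnBall f c ε B) (Ψ : 𝓢(Rd d, ℂ)) (hΨ : ∫ x, Ψ x ≠ 0) (α : Fin d → ℕ)
    (hα : moment f α ≠ 0) :
    ∃ w, ∫ z, iteratedFDeriv ℝ (∑ j, α j) Ψ w (fun _ => z) * f z ≠ 0 := by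
  by_contra! h
  obtain ⟨i, hi⟩ := exists_prod_coord_eq α
  refine hα ?_
  simp_rw [moment, ← hi]
  refine coeff_eq_zero_of_forall_sum_iteratedFDeriv_eq_zero Ψ hΨ
    (fun i => ∫ z, ((∏ l, z (i l) : ℝ) : ℂ) * f z) (fun σ j => ?_) (fun w => ?_) i
  · simp only [Function.comp_apply]
    congr! 4 with z
    exact Equiv.prod_comp σ (fun l => z (j l))
  · rw [← hf.integral_multilinear_eq_sum, h w]

/-! ### Vanishing moments of elements of the Hardy space -/

theorem convDilated_toTemperedDistribution {d : ℕ} (Ψ : 𝓢(Rd d, ℂ))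
    (F : Lp ℂ ∞ (volume : Measure (Rd d))) (ζ : {ζ : ℝ // 0 < ζ}) (x : Rd d) :
    convDilated Ψ (Lp.toTemperedDistribution F) ζ x = ∫ z, dilatedKernel Ψ ζ x z * F z := by
  simp [convDilated]

/-- At large scales the convolution is governed by the lowest order nonvanishing moments. -/
theorem BoundedOnBall.exists_le_norm_integral_dilatedKernel {d : ℕ} (hd : 1 ≤ d) {f : Rd d → ℂ}
    {a : Rd d} {ε B : ℝ} (hf : BoundedOnBall f a ε B) (hε : 0 < ε) (Ψ : 𝓢(Rd d, ℂ)) (k : ℕ)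
    (hlow : ∀ α : Fin d → ℕ, ∑ i, α i < k → moment f α = 0)
    (hk : ∃ w, ∫ z, iteratedFDeriv ℝ k Ψ w (fun _ => z) * f z ≠ 0) :
    ∃ (w₀ : Rd d) (δ c ζ₀ : ℝ), 0 < δ ∧ 0 < c ∧ 1 ≤ ζ₀ ∧ δ < ‖w₀‖ ∧
      ∀ (ζ : {ζ : ℝ // 0 < ζ}), ζ₀ ≤ ζ → ∀ w ∈ Metric.ball w₀ δ,
        c * (((ζ : ℝ) ^ (d + k))⁻¹) ≤ ‖∫ z, dilatedKernel Ψ ζ ((ζ : ℝ) • w) z * f z‖ := by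
  have : Nontrivial (Rd d) :=
    Module.nontrivial_of_finrank_pos (R := ℝ) (by rw [finrank_euclideanSpace_fin]; omega)
  obtain ⟨w₁, hw₁⟩ := hk
  set G : Rd d → ℂ := fun w => ∫ z, iteratedFDeriv ℝ k Ψ w (fun _ => z) * f z with hG
  have hGc : Continuous G := by
    simp only [hG, hf.integral_multilinear_eq_sum]
    have := (Ψ.smooth k).continuous_iteratedFDeriv'
    fun_prop
  set c₀ : ℝ := ‖G w₁‖ / 2 with hc₀
  have hc₀pos : 0 < c₀ := half_pos (norm_pos_iff.2 hw₁)
  have hopen : IsOpen {w | c₀ < ‖G w‖} := isOpen_lt continuous_const hGc.norm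
  have hmem : w₁ ∈ {w | c₀ < ‖G w‖} := half_lt_self (norm_pos_iff.2 hw₁)
  -- Move away from the origin, so that the dilates of a small ball escape to infinity.
  obtain ⟨w₀, hw₀, hw₀0⟩ : ∃ w₀, c₀ < ‖G w₀‖ ∧ w₀ ≠ 0 := by
    obtain ⟨w, hw, hw0⟩ := (dense_compl_singleton (0 : Rd d)).inter_open_nonempty _ hopen ⟨w₁, hmem⟩
    exact ⟨w, hw, hw0⟩
  obtain ⟨δ₀, hδ₀, hball⟩ := Metric.isOpen_iff.1 hopen w₀ hw₀
  set ρ := ‖a‖ + ε with hρ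
  set K := SchwartzMap.seminorm ℝ 0 (k + 1) Ψ with hK
  have hB := hf.nonneg_bound
  set V := volume.real (Metric.ball (0 : Rd d) 1) with hV
  have hV0 : 0 ≤ V := measureReal_nonneg
  have hK0 : 0 ≤ K := apply_nonneg _ _
  set C' := K * ρ ^ (k + 1) * B * (V * ε ^ d) with hC'
  have hC'0 : 0 ≤ C' := by positivity
  set c₁ := ((k.factorial : ℝ)⁻¹) * c₀ with hc₁
  have hc₁pos : 0 < c₁ := by positivity
  refine ⟨w₀, min δ₀ (‖w₀‖ / 2), c₁ / 2, 2 * C' / c₁ + 1, ?_, by positivity, ?_, ?_, ?_⟩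
  · have := norm_pos_iff.2 hw₀0
    positivity
  · have : 0 ≤ 2 * C' / c₁ := by positivity
    linarith
  · exact (min_le_right _ _).trans_lt (half_lt_self (norm_pos_iff.2 hw₀0))
  intro ζ hζ w hw
  have hζ0 := ζ.2
  have hGw : c₀ < ‖G w‖ := hball (Metric.ball_subset_ball (min_le_left _ _) hw)
  set φ := dilatedKernel Ψ ζ ((ζ : ℝ) • w) with hφ
  have hrem : ‖∫ z, (φ z - taylorPoly k φ 0 z) * f z‖ ≤ C' * (((ζ : ℝ) ^ (d + k + 1))⁻¹) := by
    have hS : ∀ z ∈ Metric.ball a ε, ‖φ z - taylorPoly k φ 0 z‖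
        ≤ (((ζ : ℝ) ^ (d + k + 1))⁻¹) * K * ρ ^ (k + 1) := by
      intro z hz
      have hzρ : ‖z - 0‖ ≤ ρ := by
        rw [sub_zero]
        have h1 : ‖z - a‖ < ε := by simpa [dist_eq_norm] using hz
        have h2 := norm_add_le a (z - a)
        rw [add_sub_cancel] at h2
        linarith
      refine (norm_sub_taylorPoly_le k φ 0 z ((((ζ : ℝ) ^ (d + k + 1))⁻¹) * K)
        fun t _ => ?_).trans (by gcongr)
      rw [hφ, norm_iteratedFDeriv_dilatedKernel, ← add_assoc]
      gcongr
      simpa using Ψ.le_seminorm ℝ 0 (k + 1) _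
    refine (hf.norm_integral_mul_le hε hS).trans (le_of_eq ?_)
    rw [hC']
    ring
  have htay : ∫ z, taylorPoly k φ 0 z * f z
      = (((k.factorial : ℝ)⁻¹) * ((((ζ : ℝ) ^ d)⁻¹) * (-(ζ : ℝ)⁻¹) ^ k)) • G w := by
    rw [hf.integral_taylorPoly, Finset.sum_range_succ, Finset.sum_eq_zero, zero_add]
    · rw [mul_smul, hG, hφ]
      simp_rw [iteratedFDeriv_dilatedKernel, sub_zero, smul_smul, inv_mul_cancel₀ hζ0.ne', one_smul,
        smul_apply, smul_mul_assoc]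
      rw [integral_smul, smul_smul]
    · intro m hm
      have hM : maxMoment m f = 0 := maxMoment_eq_zero fun α hα =>
        hlow α (hα.trans_lt (Finset.mem_range.1 hm))
      have := hf.norm_integral_multilinear_le (le_refl m) 0 (iteratedFDeriv ℝ m φ 0)
      rw [hM, mul_zero, norm_le_zero_iff] at this
      rw [this, smul_zero]
  have hsplit : ∫ z, φ z * f z
      = (∫ z, (φ z - taylorPoly k φ 0 z) * f z) + ∫ z, taylorPoly k φ 0 z * f z := by
    rw [← integral_add (hf.integrable_mul (g := fun z => φ z - taylorPoly k φ 0 z)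
      (φ.continuous.sub (continuous_taylorPoly k φ 0))) (hf.integrable_mul (continuous_taylorPoly k φ 0))]
    refine integral_congr_ae (Filter.Eventually.of_forall fun z => ?_)
    simp only
    ring
  have hmain : c₁ * (((ζ : ℝ) ^ (d + k))⁻¹) ≤ ‖∫ z, taylorPoly k φ 0 z * f z‖ := by
    rw [htay, norm_smul, norm_mul, norm_mul, norm_pow, norm_neg,
      Real.norm_of_nonneg (by positivity), Real.norm_of_nonneg (by positivity),
      Real.norm_of_nonneg (by positivity), hc₁, pow_add, mul_inv, inv_pow]
    calc _ = ((k.factorial : ℝ)⁻¹ * ((((ζ : ℝ) ^ d)⁻¹) * (((ζ : ℝ) ^ k)⁻¹))) * c₀ := by ring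
      _ ≤ _ := by gcongr
  have hsmall : C' * (((ζ : ℝ) ^ (d + k + 1))⁻¹) ≤ c₁ / 2 * (((ζ : ℝ) ^ (d + k))⁻¹) := by
    have h1 : C' ≤ c₁ / 2 * ζ := by
      have : 2 * C' / c₁ ≤ ζ := by linarith
      rw [div_le_iff₀ hc₁pos] at this
      linarith
    rw [pow_succ, mul_inv]
    calc _ ≤ (c₁ / 2 * ζ) * (((ζ : ℝ) ^ (d + k))⁻¹ * ((ζ : ℝ))⁻¹) := by gcongr
      _ = _ := by field_simp
  rw [hsplit]
  have h3 := norm_sub_le_norm_add (∫ z, taylorPoly k φ 0 z * f z)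
    (∫ z, (φ z - taylorPoly k φ 0 z) * f z)
  rw [add_comm (∫ z, taylorPoly k φ 0 z * f z)] at h3
  linarith

/-- A function that is at least `c ζ^{-(d+k)}` on the dilates by `ζ` of a fixed ball, with
`p (d + k) ≤ d`, is not in `L^p`: each dilate contributes a fixed amount to the integral. -/
theorem lintegral_rpow_eq_top_of_le {d k : ℕ} {p : ℝ} (hp : 0 < p) (hpk : p * (d + k) ≤ d)
    (m : Rd d → ℝ≥0∞) {w₀ : Rd d} {δ c ζ₀ : ℝ} (hδ : 0 < δ) (hc : 0 < c) (hζ₀ : 1 ≤ ζ₀)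
    (hδw : δ < ‖w₀‖)
    (hm : ∀ ζ : ℝ, ζ₀ ≤ ζ → ∀ w ∈ Metric.ball w₀ δ,
      ENNReal.ofReal (c * ((ζ ^ (d + k))⁻¹)) ≤ m (ζ • w)) :
    ∫⁻ x, m x ^ p = ∞ := by
  by_contra hfin
  set ν := volume.withDensity fun x => m x ^ p with hν
  have : IsFiniteMeasure ν := isFiniteMeasure_withDensity hfin
  set s : ℕ → Set (Rd d) := fun n => {x | (n : ℝ) ≤ ‖x‖} with hs
  have hsm : ∀ n, MeasurableSet (s n) := fun n =>
    (isClosed_le continuous_const continuous_norm).measurableSet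
  have htend := tendsto_measure_iInter_atTop (μ := ν) (s := s)
    (fun n => (hsm n).nullMeasurableSet)
    (fun i j hij x hx => le_trans (by exact_mod_cast hij) (show (j : ℝ) ≤ ‖x‖ from hx))
    ⟨0, measure_ne_top _ _⟩
  have hempty : ⋂ n, s n = ∅ := by
    refine Set.eq_empty_of_forall_notMem fun x hx => ?_
    obtain ⟨n, hn⟩ := exists_nat_gt ‖x‖
    exact absurd (show (n : ℝ) ≤ ‖x‖ from Set.mem_iInter.1 hx n) (not_le.2 hn)
  rw [hempty, measure_empty] at htend
  set κ := ENNReal.ofReal (c ^ p * δ ^ d) * volume (Metric.ball (0 : Rd d) 1) with hκ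
  have hκ0 : 0 < κ := ENNReal.mul_pos (ENNReal.ofReal_pos.2 (by positivity)).ne'
    (Metric.measure_ball_pos _ _ one_pos).ne'
  obtain ⟨n, hn⟩ := (htend.eventually (gt_mem_nhds hκ0)).exists
  refine absurd hn (not_lt.2 ?_)
  -- At this scale the dilated ball lies in `{‖x‖ ≥ n}`, since its points have norm at least
  -- `ζ (‖w₀‖ - δ)`.
  have hgap : 0 < ‖w₀‖ - δ := sub_pos.2 hδw
  set ζ := max ζ₀ (n / (‖w₀‖ - δ)) with hζ
  have hζ1 : 1 ≤ ζ := hζ₀.trans (le_max_left _ _)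
  have hζ0 : 0 < ζ := by linarith
  have hball : ∀ x ∈ Metric.ball (ζ • w₀) (ζ * δ), ∃ w ∈ Metric.ball w₀ δ, x = ζ • w := by
    intro x hx
    refine ⟨ζ⁻¹ • x, ?_, by rw [smul_smul, mul_inv_cancel₀ hζ0.ne', one_smul]⟩
    rw [mem_ball_iff_norm] at hx ⊢
    have : ζ⁻¹ • x - w₀ = ζ⁻¹ • (x - ζ • w₀) := by
      rw [smul_sub, smul_smul, inv_mul_cancel₀ hζ0.ne', one_smul]
    rw [this, norm_smul, Real.norm_of_nonneg (by positivity), inv_mul_lt_iff₀ hζ0]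
    exact hx
  have hsub : Metric.ball (ζ • w₀) (ζ * δ) ⊆ s n := by
    intro x hx
    obtain ⟨w, hw, rfl⟩ := hball x hx
    have h1 : ‖w₀‖ - δ ≤ ‖w‖ := by
      have h2 : ‖w - w₀‖ < δ := mem_ball_iff_norm.1 hw
      have h3 := norm_sub_norm_le w₀ w
      rw [norm_sub_rev] at h3
      linarith
    have h4 : n / (‖w₀‖ - δ) ≤ ζ := le_max_right _ _
    rw [div_le_iff₀ hgap] at h4
    change (n : ℝ) ≤ ‖ζ • w‖
    rw [norm_smul, Real.norm_of_nonneg hζ0.le]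
    exact h4.trans (by gcongr)
  refine le_trans ?_ (measure_mono hsub)
  rw [hν, withDensity_apply _ measurableSet_ball]
  calc κ ≤ ENNReal.ofReal ((c * ((ζ ^ (d + k))⁻¹)) ^ p) * volume (Metric.ball (ζ • w₀) (ζ * δ)) := by
        rw [Measure.addHaar_ball_of_pos _ _ (by positivity), finrank_euclideanSpace_fin, ← mul_assoc,
          ← ENNReal.ofReal_mul (by positivity), hκ]
        refine mul_le_mul' (ENNReal.ofReal_le_ofReal ?_) le_rfl
        rw [Real.mul_rpow hc.le (by positivity), mul_pow]
        have h5 : 1 ≤ (((ζ ^ (d + k))⁻¹)) ^ p * ζ ^ d := by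
          rw [Real.inv_rpow (by positivity), ← Real.rpow_natCast ζ (d + k), ← Real.rpow_mul hζ0.le,
            ← Real.rpow_neg hζ0.le, ← Real.rpow_natCast ζ d, ← Real.rpow_add hζ0]
          refine Real.one_le_rpow hζ1 ?_
          push_cast
          linarith
        calc c ^ p * δ ^ d = c ^ p * δ ^ d * 1 := by ring
          _ ≤ c ^ p * δ ^ d * ((((ζ ^ (d + k))⁻¹)) ^ p * ζ ^ d) := by gcongr
          _ = _ := by ring
    _ = ∫⁻ _x in Metric.ball (ζ • w₀) (ζ * δ), ENNReal.ofReal ((c * ((ζ ^ (d + k))⁻¹)) ^ p) := by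
        rw [setLIntegral_const]
    _ ≤ _ := by
        refine setLIntegral_mono' measurableSet_ball fun x hx => ?_
        obtain ⟨w, hw, rfl⟩ := hball x hx
        rw [← ENNReal.ofReal_rpow_of_nonneg (by positivity) hp.le]
        exact ENNReal.rpow_le_rpow (hm ζ (le_max_left _ _) w hw) hp.le

/-- A bounded function with compact support that belongs to `H^p` has vanishing moments up to the
order `N`. -/
theorem moment_eq_zero_of_mem_hardySpace {d : ℕ} (hd : 1 ≤ d) (Ψ : 𝓢(Rd d, ℂ))
    (hΨ : ∫ x, Ψ x ≠ 0) {p : ℝ} (hp : 0 < p) {N : ℕ} (hpN : p * (d + N) ≤ d)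
    (F : Lp ℂ ∞ (volume : Measure (Rd d))) {a : Rd d} {ε B : ℝ} (hF : BoundedOnBall F a ε B)
    (hε : 0 < ε) (hmem : Lp.toTemperedDistribution F ∈ hardySpace Ψ p) (α : Fin d → ℕ)
    (hα : ∑ i, α i ≤ N) : moment F α = 0 := by
  suffices h : ∀ k ≤ N, ∀ α : Fin d → ℕ, ∑ i, α i = k → moment F α = 0 from h _ hα α rfl
  intro k
  induction k using Nat.strong_induction_on with
  | _ k ih =>
    intro hkN α hαk
    by_contra hne
    have hG := hF.exists_integral_iteratedFDeriv_ne_zero Ψ hΨ α hne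
    rw [hαk] at hG
    obtain ⟨w₀, δ, c, ζ₀, hδ, hc, hζ₀, hδw, hlow⟩ :=
      hF.exists_le_norm_integral_dilatedKernel hd hε Ψ k
        (fun β hβ => ih _ hβ (hβ.le.trans hkN) β rfl) hG
    have hpk : p * (d + k) ≤ d := by
      refine le_trans ?_ hpN
      have : (k : ℝ) ≤ N := by exact_mod_cast hkN
      gcongr
    have htop := lintegral_rpow_eq_top_of_le hp hpk
      (radialMaximal Ψ (Lp.toTemperedDistribution F)) hδ hc hζ₀ hδw fun ζ hζ w hw => by
        have hζ0 : 0 < ζ := by linarith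
        refine le_trans ?_ (le_iSup _ (⟨ζ, hζ0⟩ : {ζ : ℝ // 0 < ζ}))
        rw [convDilated_toTemperedDistribution, ← ofReal_norm]
        exact ENNReal.ofReal_le_ofReal (hlow ⟨ζ, hζ0⟩ hζ w hw)
    have hfin : hardyNorm Ψ p (Lp.toTemperedDistribution F) < ∞ := hmem
    rw [hardyNorm, htop, ENNReal.top_rpow_of_pos (by positivity)] at hfin
    exact lt_irrefl _ hfin

/-! ### Pointwise bounds for the maximal function -/

theorem norm_iteratedFDeriv_dilatedKernel_le {d : ℕ} (Ψ : 𝓢(Rd d, ℂ)) (ζ : {ζ : ℝ // 0 < ζ})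
    (x a : Rd d) (n : ℕ) {σ : ℝ} (hσ : 0 < σ) (h : σ / 2 ≤ ‖x - a‖) :
    ‖iteratedFDeriv ℝ n (dilatedKernel Ψ ζ x) a‖
      ≤ 2 ^ (d + n) * SchwartzMap.seminorm ℝ (d + n) n Ψ * (σ ^ (d + n))⁻¹ := by
  have h1 := norm_iteratedFDeriv_dilatedKernel_mul_le Ψ ζ x a n
  have h2 : ‖iteratedFDeriv ℝ n (dilatedKernel Ψ ζ x) a‖ * (σ / 2) ^ (d + n)
      ≤ SchwartzMap.seminorm ℝ (d + n) n Ψ := le_trans (by gcongr) h1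
  rw [div_pow, mul_div_assoc', div_le_iff₀ (by positivity)] at h2
  rw [← div_eq_mul_inv, le_div_iff₀ (by positivity), mul_comm (2 ^ (d + n))]
  exact h2

namespace BoundedOnBall

variable {d : ℕ} {f : Rd d → ℂ} {y : Rd d} {ε B : ℝ}

theorem norm_integral_dilatedKernel_le (hf : BoundedOnBall f y ε B) (Ψ : 𝓢(Rd d, ℂ))
    (ζ : {ζ : ℝ // 0 < ζ}) (x : Rd d) :
    ‖∫ z, dilatedKernel Ψ ζ x z * f z‖ ≤ B * ∫ z, ‖Ψ z‖ := by
  rw [← integral_norm_dilatedKernel Ψ ζ x, ← integral_const_mul]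
  refine norm_integral_le_of_norm_le ((dilatedKernel Ψ ζ x).integrable.norm.const_mul B) ?_
  filter_upwards [hf.bound] with z hz
  rw [norm_mul, mul_comm]
  gcongr

/-- Away from the support, the error made by replacing the kernel by its Taylor polynomial. -/
theorem norm_integral_sub_taylorPoly_le (hf : BoundedOnBall f y ε B) (hε : 0 < ε) (Ψ : 𝓢(Rd d, ℂ))
    (ζ : {ζ : ℝ // 0 < ζ}) (x : Rd d) (hx : 2 * ε < ‖x - y‖) (N : ℕ) :
    ‖(∫ z, dilatedKernel Ψ ζ x z * f z) - ∫ z, taylorPoly N (dilatedKernel Ψ ζ x) y z * f z‖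
      ≤ 2 ^ (d + (N + 1)) * SchwartzMap.seminorm ℝ (d + (N + 1)) (N + 1) Ψ
        * volume.real (Metric.ball (0 : Rd d) 1)
        * (ε ^ (d + (N + 1)) * B) * (‖x - y‖ ^ (d + (N + 1)))⁻¹ := by
  set φ := dilatedKernel Ψ ζ x with hφ
  have hcont := continuous_taylorPoly N φ y
  rw [← integral_sub (hf.integrable_mul φ.continuous) (hf.integrable_mul hcont)]
  simp_rw [← sub_mul]
  set S := 2 ^ (d + (N + 1)) * SchwartzMap.seminorm ℝ (d + (N + 1)) (N + 1) Ψ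
    * (‖x - y‖ ^ (d + (N + 1)))⁻¹ with hS
  have hS0 : 0 ≤ S := by positivity
  have hbound : ∀ z ∈ Metric.ball y ε, ‖φ z - taylorPoly N φ y z‖ ≤ S * ε ^ (N + 1) := by
    intro z hz
    have hz' : ‖z - y‖ < ε := mem_ball_iff_norm.1 hz
    refine (norm_sub_taylorPoly_le N φ y z S fun t ht => ?_).trans (by gcongr)
    refine norm_iteratedFDeriv_dilatedKernel_le Ψ ζ x _ (N + 1) (by linarith) ?_
    have h1 : ‖t • (z - y)‖ ≤ ε := by
      rw [norm_smul, Real.norm_of_nonneg ht.1]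
      exact (mul_le_of_le_one_left (norm_nonneg _) ht.2).trans hz'.le
    have h2 := norm_sub_norm_le (x - y) (t • (z - y))
    rw [sub_sub] at h2
    linarith
  refine (hf.norm_integral_mul_le hε hbound).trans (le_of_eq ?_)
  rw [hS, pow_add ε d (N + 1)]
  ring

/-- The Taylor polynomial part, at distances at most `4 R`. -/
theorem norm_integral_taylorPoly_le_of_near (hf : BoundedOnBall f y ε B) (Ψ : 𝓢(Rd d, ℂ))
    (ζ : {ζ : ℝ // 0 < ζ}) (x : Rd d) (N : ℕ) {R Y : ℝ} (hx0 : 0 < ‖x - y‖) (hx : ‖x - y‖ ≤ 4 * R)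
    (hY : 0 ≤ Y) (hy : ‖y‖ ≤ Y + R) :
    ‖∫ z, taylorPoly N (dilatedKernel Ψ ζ x) y z * f z‖
      ≤ (∑ k ∈ Finset.range (N + 1), d ^ k * 2 ^ k
          * (2 ^ (d + k) * SchwartzMap.seminorm ℝ (d + k) k Ψ)) * 4 ^ N
        * (max 1 R ^ N * ((1 + Y / max 1 R) ^ N * maxMoment N f)) * (‖x - y‖ ^ (d + N))⁻¹ := by
  refine (hf.norm_integral_taylorPoly_le N _ y).trans ?_
  rw [Finset.sum_mul, Finset.sum_mul, Finset.sum_mul]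
  refine Finset.sum_le_sum fun k hk => ?_
  have hkN : k ≤ N := Nat.lt_succ_iff.1 (Finset.mem_range.1 hk)
  set r := max 1 R with hr
  set s := ‖x - y‖ with hs
  have hr1 : 1 ≤ r := le_max_left _ _
  have hrR : R ≤ r := le_max_right _ _
  have hM := maxMoment_nonneg N f
  have hD := norm_iteratedFDeriv_dilatedKernel_le Ψ ζ x y k hx0 (half_le_self hx0.le)
  set A := 1 + Y / r with hA
  have hA1 : 1 ≤ A := by
    have : 0 ≤ Y / r := by positivity
    linarith
  have hy1 : 1 + ‖y‖ ≤ 2 * r * A := by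
    have : r * A = r + Y := by rw [hA]; field_simp
    linarith
  -- As `s ≤ 4 r`, the term of order `N` dominates those of lower order.
  have hratio : r ^ k * (s ^ (d + k))⁻¹ ≤ 4 ^ N * (r ^ N * (s ^ (d + N))⁻¹) := by
    have h1 : 1 ≤ 4 * r / s := by
      rw [le_div_iff₀ hx0]
      linarith
    have h2 : (4 * r / s) ^ k ≤ (4 * r / s) ^ N := pow_le_pow_right₀ h1 hkN
    have h3 : (r / s) ^ k ≤ (4 * r / s) ^ k := by
      gcongr
      linarith
    have h4 := h3.trans h2
    calc r ^ k * (s ^ (d + k))⁻¹ = (r / s) ^ k * (s ^ d)⁻¹ := by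
          rw [pow_add, div_pow]
          field_simp
      _ ≤ (4 * r / s) ^ N * (s ^ d)⁻¹ := by gcongr
      _ = _ := by
          rw [pow_add, div_pow, mul_pow]
          field_simp
  have hK : 0 ≤ SchwartzMap.seminorm ℝ (d + k) k Ψ := apply_nonneg _ _
  set Q := 2 ^ (d + k) * SchwartzMap.seminorm ℝ (d + k) k Ψ with hQ
  have hQ0 : 0 ≤ Q := by positivity
  calc (d : ℝ) ^ k * (1 + ‖y‖) ^ k * ‖iteratedFDeriv ℝ k (dilatedKernel Ψ ζ x) y‖ * maxMoment N f
      ≤ d ^ k * (2 * r * A) ^ k * (Q * (s ^ (d + k))⁻¹) * maxMoment N f := by gcongr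
    _ = d ^ k * 2 ^ k * Q * (r ^ k * (s ^ (d + k))⁻¹) * (A ^ k * maxMoment N f) := by
        rw [mul_pow, mul_pow]
        ring
    _ ≤ d ^ k * 2 ^ k * Q * (4 ^ N * (r ^ N * (s ^ (d + N))⁻¹)) * (A ^ N * maxMoment N f) := by
        gcongr
    _ = _ := by ring

/-- The change of base point from `y` to `y₀`, at distances at least `3 R`. -/
theorem norm_integral_taylorPoly_sub_le_of_far (hf : BoundedOnBall f y ε B) (Ψ : 𝓢(Rd d, ℂ))
    (ζ : {ζ : ℝ // 0 < ζ}) (x : Rd d) (N : ℕ) {R : ℝ} (hR : 0 < R) {y₀ : Rd d}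
    (hy : ‖y - y₀‖ ≤ R) (hx : 3 * R ≤ ‖x - y₀‖) :
    ‖(∫ z, taylorPoly N (dilatedKernel Ψ ζ x) y z * f z)
        - ∫ z, taylorPoly N (dilatedKernel Ψ ζ x) y₀ z * f z‖
      ≤ d ^ N * 2 ^ N * (2 ^ (d + (N + 1)) * SchwartzMap.seminorm ℝ (d + (N + 1)) (N + 1) Ψ)
        * (R * (max 1 R ^ N * ((1 + ‖y₀‖ / max 1 R) ^ N * maxMoment N f)))
        * (‖x - y₀‖ ^ (d + (N + 1)))⁻¹ := by
  set Q := 2 ^ (d + (N + 1)) * SchwartzMap.seminorm ℝ (d + (N + 1)) (N + 1) Ψ with hQ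
  have hQ0 : 0 ≤ Q := by
    have : 0 ≤ SchwartzMap.seminorm ℝ (d + (N + 1)) (N + 1) Ψ := apply_nonneg _ _
    positivity
  have hseg : ∀ t ∈ Set.Icc (0 : ℝ) 1, ‖t • (y - y₀)‖ ≤ R := by
    intro t ht
    rw [norm_smul, Real.norm_of_nonneg ht.1]
    exact (mul_le_of_le_one_left (norm_nonneg _) ht.2).trans hy
  refine (hf.norm_integral_taylorPoly_sub_le N (dilatedKernel Ψ ζ x) y₀ y
    (Q * (‖x - y₀‖ ^ (d + (N + 1)))⁻¹) (‖y₀‖ + R) (fun t ht => ?_) (fun t ht => ?_)).trans ?_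
  · refine norm_iteratedFDeriv_dilatedKernel_le Ψ ζ x _ (N + 1) (by linarith) ?_
    have h1 := hseg t ht
    have h2 := norm_sub_norm_le (x - y₀) (t • (y - y₀))
    rw [sub_sub] at h2
    linarith
  · exact (norm_add_le _ _).trans (add_le_add_right (hseg t ht) _)
  · set r := max 1 R with hr
    have hr1 : 1 ≤ r := le_max_left _ _
    have hrR : R ≤ r := le_max_right _ _
    have hM := maxMoment_nonneg N f
    set A := 1 + ‖y₀‖ / r with hA
    have hy1 : 1 + (‖y₀‖ + R) ≤ 2 * r * A := by
      have : r * A = r + ‖y₀‖ := by rw [hA]; field_simp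
      linarith [norm_nonneg y₀]
    calc _ ≤ d ^ N * (2 * r * A) ^ N * (Q * (‖x - y₀‖ ^ (d + (N + 1)))⁻¹ * R)
          * maxMoment N f := by gcongr
      _ = _ := by
        rw [mul_pow, mul_pow]
        ring

end BoundedOnBall

/-- The function `c |x - a|^{-n}` of `x`, cut off to the distances `|x - a| ∈ S`. -/
noncomputable def shellPower {d : ℕ} (S : Set ℝ) (c : ℝ) (n : ℕ) (a x : Rd d) : ℝ≥0∞ :=
  S.indicator (fun s => ENNReal.ofReal (c * (s ^ n)⁻¹)) ‖x - a‖

theorem shellPower_of_mem {d : ℕ} {S : Set ℝ} (c : ℝ) (n : ℕ) {a x : Rd d} (h : ‖x - a‖ ∈ S) :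
    shellPower S c n a x = ENNReal.ofReal (c * (‖x - a‖ ^ n)⁻¹) :=
  Set.indicator_of_mem h _

theorem measurable_shellPower {d : ℕ} {S : Set ℝ} (hS : MeasurableSet S) (c : ℝ) (n : ℕ)
    (a : Rd d) : Measurable (shellPower S c n a) := by
  have : Measurable (S.indicator fun s => ENNReal.ofReal (c * (s ^ n)⁻¹)) :=
    Measurable.indicator (by fun_prop) hS
  exact this.comp (by fun_prop)

theorem lintegral_shellPower_rpow {d : ℕ} {S : Set ℝ} (hS : MeasurableSet S)
    (hS0 : S ⊆ Set.Ioi 0) {c : ℝ} (hc : 0 ≤ c) (n : ℕ) (a : Rd d) {p : ℝ} (hp : 0 < p) :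
    ∫⁻ x, shellPower S c n a x ^ p = ENNReal.ofReal (c ^ p) *
      ∫⁻ x : Rd d, S.indicator (fun s => ENNReal.ofReal (s ^ (-(p * n)))) ‖x - a‖ := by
  rw [← lintegral_const_mul]
  · refine lintegral_congr fun x => ?_
    by_cases hx : ‖x - a‖ ∈ S
    · have hx0 : 0 < ‖x - a‖ := hS0 hx
      rw [shellPower_of_mem c n hx, Set.indicator_of_mem hx, ← ENNReal.ofReal_mul (by positivity),
        ENNReal.ofReal_rpow_of_nonneg (by positivity) hp.le, Real.mul_rpow hc (by positivity),
        Real.inv_rpow (by positivity), ← Real.rpow_natCast, ← Real.rpow_mul hx0.le,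
        ← Real.rpow_neg hx0.le, mul_comm p]
    · rw [shellPower, Set.indicator_of_notMem hx, Set.indicator_of_notMem hx,
        ENNReal.zero_rpow_of_pos hp, mul_zero]
  · have : Measurable (S.indicator fun s : ℝ => ENNReal.ofReal (s ^ (-(p * n)))) :=
      Measurable.indicator (by fun_prop) hS
    exact this.comp (by fun_prop)

/-- The majorant of the contribution of one summand to the maximal function: a constant near its
support, the Taylor remainder away from it, and the moments, which decay with one more power beyond
the distance `2 R` from `y₀`. -/
noncomputable def majorant {d : ℕ} (N : ℕ) (C : ℝ) (y y₀ : Rd d) (ε R B D : ℝ) (x : Rd d) :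
    ℝ≥0∞ :=
  shellPower (Set.Iic (2 * ε)) (C * B) 0 y x
    + shellPower (Set.Ioi (2 * ε)) (C * (ε ^ (d + (N + 1)) * B)) (d + (N + 1)) y x
    + shellPower (Set.Ioc (2 * ε) (4 * R)) (C * (max 1 R ^ N * D)) (d + N) y x
    + shellPower (Set.Ioi (2 * R)) (C * (R * (max 1 R ^ N * D))) (d + (N + 1)) y₀ x

theorem exists_enorm_integral_le_majorant {d : ℕ} (N : ℕ) (Ψ : 𝓢(Rd d, ℂ)) :
    ∃ C : ℝ, 0 ≤ C ∧ ∀ (f : Rd d → ℂ) (y y₀ : Rd d) (ε R B : ℝ), BoundedOnBall f y ε B →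
      0 < ε → ε ≤ R → ‖y - y₀‖ < R → ∀ (ζ : {ζ : ℝ // 0 < ζ}) (x : Rd d),
      (‖x - y₀‖ < 3 * R → ‖∫ z, dilatedKernel Ψ ζ x z * f z‖ₑ
        ≤ majorant N C y y₀ ε R B ((1 + ‖y₀‖ / max 1 R) ^ N * maxMoment N f) x) ∧
      (3 * R ≤ ‖x - y₀‖ → ‖(∫ z, dilatedKernel Ψ ζ x z * f z)
          - ∫ z, taylorPoly N (dilatedKernel Ψ ζ x) y₀ z * f z‖ₑ
        ≤ majorant N C y y₀ ε R B ((1 + ‖y₀‖ / max 1 R) ^ N * maxMoment N f) x) := by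
  set C₁ := ∫ z, ‖Ψ z‖ with hC₁
  set C₂ := 2 ^ (d + (N + 1)) * SchwartzMap.seminorm ℝ (d + (N + 1)) (N + 1) Ψ
    * volume.real (Metric.ball (0 : Rd d) 1) with hC₂
  set C₃ := (∑ k ∈ Finset.range (N + 1), (d : ℝ) ^ k * 2 ^ k
    * (2 ^ (d + k) * SchwartzMap.seminorm ℝ (d + k) k Ψ)) * 4 ^ N with hC₃
  set C₄ := (d : ℝ) ^ N * 2 ^ N
    * (2 ^ (d + (N + 1)) * SchwartzMap.seminorm ℝ (d + (N + 1)) (N + 1) Ψ) with hC₄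
  have hC₁0 : 0 ≤ C₁ := integral_nonneg fun _ => norm_nonneg _
  have hC₂0 : 0 ≤ C₂ := by positivity
  have hC₃0 : 0 ≤ C₃ := mul_nonneg (Finset.sum_nonneg fun _ _ => by positivity) (by positivity)
  have hC₄0 : 0 ≤ C₄ := by positivity
  set C := C₁ + C₂ + C₃ + C₄ with hC
  refine ⟨C, by positivity, fun f y y₀ ε R B hf hε hεR hy ζ x => ?_⟩
  have hB := hf.nonneg_bound
  have hM := maxMoment_nonneg N f
  have hR : 0 < R := hε.trans_le hεR
  have hr : 0 < max 1 R := lt_max_of_lt_left one_pos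
  set D := (1 + ‖y₀‖ / max 1 R) ^ N * maxMoment N f with hD
  have hD0 : 0 ≤ D := by positivity
  set φ := dilatedKernel Ψ ζ x with hφ
  have hrem : 2 * ε < ‖x - y‖ → ‖(∫ z, φ z * f z) - ∫ z, taylorPoly N φ y z * f z‖ₑ
      ≤ shellPower (Set.Ioi (2 * ε)) (C * (ε ^ (d + (N + 1)) * B)) (d + (N + 1)) y x := by
    intro hx
    rw [shellPower_of_mem _ _ (Set.mem_Ioi.2 hx), ← ofReal_norm]
    refine ENNReal.ofReal_le_ofReal
      ((hf.norm_integral_sub_taylorPoly_le hε Ψ ζ x hx N).trans ?_)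
    rw [← hC₂]
    gcongr
    linarith
  refine ⟨fun hx₀ => ?_, fun hx₀ => ?_⟩
  · have hx4 : ‖x - y‖ ≤ 4 * R := by
      have h1 := norm_sub_le_norm_sub_add_norm_sub x y₀ y
      rw [norm_sub_rev y₀ y] at h1
      linarith
    rcases le_or_gt ‖x - y‖ (2 * ε) with hx | hx
    · have h1 : ‖∫ z, φ z * f z‖ₑ ≤ shellPower (Set.Iic (2 * ε)) (C * B) 0 y x := by
        rw [shellPower_of_mem _ _ (Set.mem_Iic.2 hx), ← ofReal_norm]
        refine ENNReal.ofReal_le_ofReal ((hf.norm_integral_dilatedKernel_le Ψ ζ x).trans ?_)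
        rw [pow_zero, inv_one, mul_one, mul_comm, ← hC₁]
        gcongr
        linarith
      refine h1.trans ?_
      rw [majorant, add_assoc, add_assoc]
      exact le_self_add
    · have h2 : ‖∫ z, taylorPoly N φ y z * f z‖ₑ
          ≤ shellPower (Set.Ioc (2 * ε) (4 * R)) (C * (max 1 R ^ N * D)) (d + N) y x := by
        rw [shellPower_of_mem _ _ (Set.mem_Ioc.2 ⟨hx, hx4⟩), ← ofReal_norm]
        have hyR : ‖y‖ ≤ ‖y₀‖ + R := by
          have h1 := norm_sub_norm_le y y₀
          linarith
        refine ENNReal.ofReal_le_ofReal ((hf.norm_integral_taylorPoly_le_of_near Ψ ζ x N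
          (by linarith) hx4 (norm_nonneg y₀) hyR).trans ?_)
        rw [← hC₃, ← hD]
        gcongr
        linarith
      have h3 : ‖∫ z, φ z * f z‖ₑ ≤ ‖(∫ z, φ z * f z) - ∫ z, taylorPoly N φ y z * f z‖ₑ
          + ‖∫ z, taylorPoly N φ y z * f z‖ₑ := by
        conv_lhs => rw [← sub_add_cancel (∫ z, φ z * f z) (∫ z, taylorPoly N φ y z * f z)]
        exact enorm_add_le _ _
      refine (h3.trans (add_le_add (hrem hx) h2)).trans ?_
      rw [majorant]
      refine le_trans ?_ le_self_add
      rw [add_assoc]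
      exact le_add_self
  · have hx : 2 * ε < ‖x - y‖ := by
      have h1 := norm_sub_le_norm_sub_add_norm_sub x y y₀
      linarith
    have h2 : ‖(∫ z, taylorPoly N φ y z * f z) - ∫ z, taylorPoly N φ y₀ z * f z‖ₑ
        ≤ shellPower (Set.Ioi (2 * R)) (C * (R * (max 1 R ^ N * D))) (d + (N + 1)) y₀ x := by
      rw [shellPower_of_mem _ _ (Set.mem_Ioi.2 (by linarith)), ← ofReal_norm]
      refine ENNReal.ofReal_le_ofReal
        ((hf.norm_integral_taylorPoly_sub_le_of_far Ψ ζ x N hR hy.le hx₀).trans ?_)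
      rw [← hC₄, ← hD]
      gcongr
      linarith
    rw [← sub_add_sub_cancel _ (∫ z, taylorPoly N φ y z * f z)]
    refine ((enorm_add_le _ _).trans (add_le_add (hrem hx) h2)).trans ?_
    rw [majorant]
    refine add_le_add ?_ le_rfl
    refine le_trans ?_ le_self_add
    exact le_add_self

/-! ### Integrals of the majorant -/

theorem ENNReal.rpow_sum_le_sum_rpow {ι : Type*} (s : Finset ι) (u : ι → ℝ≥0∞) {p : ℝ}
    (hp : 0 < p) (hp1 : p ≤ 1) : (∑ i ∈ s, u i) ^ p ≤ ∑ i ∈ s, u i ^ p := by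
  classical
  induction s using Finset.induction_on with
  | empty => simp [hp]
  | insert i s hi ih =>
    rw [Finset.sum_insert hi, Finset.sum_insert hi]
    exact (ENNReal.rpow_add_le_add_rpow _ _ hp.le hp1).trans (add_le_add_right ih _)

theorem rpow_max_one_mul_rpow_le {d N : ℕ} {p R : ℝ} (hR : 0 < R) :
    (max 1 R ^ N) ^ p * R ^ ((d : ℝ) - p * (d + N))
      ≤ max (R ^ ((d : ℝ) - p * d)) (R ^ ((d : ℝ) - p * (d + N))) := by
  rcases le_total 1 R with h | h
  · rw [max_eq_right h, ← Real.rpow_natCast, ← Real.rpow_mul hR.le, ← Real.rpow_add hR]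
    refine le_trans (le_of_eq ?_) (le_max_left _ _)
    congr 1
    ring
  · rw [max_eq_left h, one_pow, Real.one_rpow, one_mul]
    exact le_max_right _ _

theorem measurable_majorant {d : ℕ} (N : ℕ) (C : ℝ) (y y₀ : Rd d) (ε R B D : ℝ) :
    Measurable (majorant N C y y₀ ε R B D) :=
  (((measurable_shellPower measurableSet_Iic _ _ _).add
    (measurable_shellPower measurableSet_Ioi _ _ _)).add
    (measurable_shellPower measurableSet_Ioc _ _ _)).add
    (measurable_shellPower measurableSet_Ioi _ _ _)

theorem lintegral_majorant_rpow_le_add {d : ℕ} (N : ℕ) (C : ℝ) (y y₀ : Rd d) (ε R B D : ℝ) {p : ℝ}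
    (hp : 0 < p) (hp1 : p ≤ 1) :
    ∫⁻ x, majorant N C y y₀ ε R B D x ^ p
      ≤ (∫⁻ x, shellPower (Set.Iic (2 * ε)) (C * B) 0 y x ^ p)
        + (∫⁻ x, shellPower (Set.Ioi (2 * ε)) (C * (ε ^ (d + (N + 1)) * B)) (d + (N + 1)) y x ^ p)
        + (∫⁻ x, shellPower (Set.Ioc (2 * ε) (4 * R)) (C * (max 1 R ^ N * D)) (d + N) y x ^ p)
        + ∫⁻ x, shellPower (Set.Ioi (2 * R)) (C * (R * (max 1 R ^ N * D))) (d + (N + 1)) y₀ x ^ p := by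
  rw [← lintegral_add_right _ ((measurable_shellPower measurableSet_Ioi _ _ _).pow_const p),
    ← lintegral_add_right _ ((measurable_shellPower measurableSet_Ioc _ _ _).pow_const p),
    ← lintegral_add_right _ ((measurable_shellPower measurableSet_Ioi _ _ _).pow_const p)]
  refine lintegral_mono fun x => ?_
  have h := fun a b : ℝ≥0∞ => ENNReal.rpow_add_le_add_rpow a b hp.le hp1
  refine (h _ _).trans (add_le_add_left ((h _ _).trans (add_le_add_left (h _ _) _)) _)

theorem lintegral_shellPower_Iic_rpow {d : ℕ} (y : Rd d) {ε c : ℝ} (hε : 0 < ε) (hc : 0 ≤ c) {p : ℝ}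
    (hp : 0 < p) : ∫⁻ x, shellPower (Set.Iic (2 * ε)) c 0 y x ^ p
      = ENNReal.ofReal (2 ^ d * volume.real (Metric.ball (0 : Rd d) 1) * (ε ^ d * c ^ p)) := by
  have h : ∀ x, shellPower (Set.Iic (2 * ε)) c 0 y x ^ p
      = (Metric.closedBall y (2 * ε)).indicator (fun _ => ENNReal.ofReal (c ^ p)) x := by
    intro x
    by_cases hx : ‖x - y‖ ≤ 2 * ε
    · rw [shellPower_of_mem _ _ (Set.mem_Iic.2 hx),
        Set.indicator_of_mem (mem_closedBall_iff_norm.2 hx), pow_zero, inv_one, mul_one,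
        ENNReal.ofReal_rpow_of_nonneg hc hp.le]
    · rw [shellPower, Set.indicator_of_notMem (by simpa using hx),
        Set.indicator_of_notMem (by simpa [dist_eq_norm] using hx), ENNReal.zero_rpow_of_pos hp]
  simp_rw [h]
  rw [lintegral_indicator_const measurableSet_closedBall, Measure.addHaar_closedBall _ _ (by linarith),
    finrank_euclideanSpace_fin, measureReal_def, ← ENNReal.ofReal_toReal
      (measure_ball_lt_top (μ := volume) (x := (0 : Rd d)) (r := 1)).ne,
    ← ENNReal.ofReal_mul (by positivity), ← ENNReal.ofReal_mul (by positivity), mul_pow,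
    ENNReal.toReal_ofReal ENNReal.toReal_nonneg]
  congr 1
  ring

theorem exists_lintegral_shellPower_Ioi_rpow_le {d : ℕ} (hd : 1 ≤ d) (n : ℕ) {p : ℝ} (hp : 0 < p)
    (h : (d : ℝ) < p * n) : ∃ K : ℝ, 0 < K ∧ ∀ (a : Rd d) (r c : ℝ), 0 < r → 0 ≤ c →
      ∫⁻ x, shellPower (Set.Ioi r) c n a x ^ p
        ≤ ENNReal.ofReal (K * (c ^ p * r ^ ((d : ℝ) - p * n))) := by
  obtain ⟨K, hK, hle⟩ := exists_lintegral_norm_rpow_tail_le hd h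
  refine ⟨K, hK, fun a r c hr hc => ?_⟩
  rw [lintegral_shellPower_rpow measurableSet_Ioi (Set.Ioi_subset_Ioi hr.le) hc n a hp]
  refine (mul_le_mul' le_rfl (hle a r hr)).trans (le_of_eq ?_)
  rw [← ENNReal.ofReal_mul (by positivity)]
  congr 1
  ring

theorem exists_lintegral_shellPower_Ioc_rpow_le {d : ℕ} (hd : 1 ≤ d) (n : ℕ) {p : ℝ} (hp : 0 < p)
    (h : p * n < d) : ∃ K : ℝ, 0 < K ∧ ∀ (a : Rd d) (r s c : ℝ), 0 < r → 0 < s → 0 ≤ c →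
      ∫⁻ x, shellPower (Set.Ioc r s) c n a x ^ p
        ≤ ENNReal.ofReal (K * (c ^ p * s ^ ((d : ℝ) - p * n))) := by
  obtain ⟨K, hK, hle⟩ := exists_lintegral_norm_rpow_ball_le hd h
  refine ⟨K, hK, fun a r s c hr hs hc => ?_⟩
  rw [lintegral_shellPower_rpow measurableSet_Ioc (fun t ht => hr.trans ht.1) hc n a hp]
  have hmono : ∫⁻ x : Rd d,
      (Set.Ioc r s).indicator (fun s => ENNReal.ofReal (s ^ (-(p * n)))) ‖x - a‖
      ≤ ∫⁻ x : Rd d, (Set.Ioc 0 s).indicator (fun s => ENNReal.ofReal (s ^ (-(p * n)))) ‖x - a‖ :=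
    lintegral_mono fun x => Set.indicator_le_indicator_of_subset (Set.Ioc_subset_Ioc_left hr.le)
      (fun _ => zero_le) _
  refine (mul_le_mul' le_rfl (hmono.trans (hle a s hs))).trans (le_of_eq ?_)
  rw [← ENNReal.ofReal_mul (by positivity)]
  congr 1
  ring

theorem exists_lintegral_shellPower_Ioc_rpow_le_log {d : ℕ} (hd : 1 ≤ d) (n : ℕ) {p : ℝ}
    (hp : 0 < p) (h : p * n ≤ d) :
    ∃ K : ℝ, 0 < K ∧ ∀ (a : Rd d) (r s c : ℝ), 0 < r → r ≤ s → 0 ≤ c →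
      ∫⁻ x, shellPower (Set.Ioc r s) c n a x ^ p
        ≤ ENNReal.ofReal (K * (c ^ p * s ^ ((d : ℝ) - p * n) * Real.log (s / r))) := by
  obtain ⟨K, hK, hle⟩ := exists_lintegral_norm_rpow_annulus_le hd
  refine ⟨K, hK, fun a r s c hr hrs hc => ?_⟩
  have hs : 0 < s := hr.trans_le hrs
  rw [lintegral_shellPower_rpow measurableSet_Ioc (fun t ht => hr.trans ht.1) hc n a hp]
  have hmono : ∫⁻ x : Rd d,
      (Set.Ioc r s).indicator (fun s => ENNReal.ofReal (s ^ (-(p * n)))) ‖x - a‖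
      ≤ ENNReal.ofReal (s ^ ((d : ℝ) - p * n)) * ∫⁻ x : Rd d,
        (Set.Ioc r s).indicator (fun s => ENNReal.ofReal (s ^ (-(d : ℝ)))) ‖x - a‖ := by
    rw [← lintegral_const_mul' _ _ ENNReal.ofReal_ne_top]
    refine lintegral_mono fun x => ?_
    by_cases hx : ‖x - a‖ ∈ Set.Ioc r s
    · have hx0 : 0 < ‖x - a‖ := hr.trans hx.1
      rw [Set.indicator_of_mem hx, Set.indicator_of_mem hx, ← ENNReal.ofReal_mul (by positivity)]
      refine ENNReal.ofReal_le_ofReal ?_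
      have e : -(p * n) = ((d : ℝ) - p * n) + -(d : ℝ) := by ring
      rw [e, Real.rpow_add hx0]
      refine mul_le_mul_of_nonneg_right ?_ (by positivity)
      exact Real.rpow_le_rpow hx0.le hx.2 (by linarith)
    · simp only [Set.indicator_of_notMem hx, zero_le]
  refine (mul_le_mul' le_rfl (hmono.trans (mul_le_mul' le_rfl (hle a r s hr hrs)))).trans
    (le_of_eq ?_)
  rw [← ENNReal.ofReal_mul (by positivity), ← ENNReal.ofReal_mul (by positivity)]
  congr 1
  ring

/-- The integral of the `p`-th power of the majorant. The shell `2 ε < |x - y| ≤ 4 R` produces the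
logarithm in the critical case `p (d + N) = d`, and no logarithm in the subcritical case. -/
theorem exists_lintegral_majorant_rpow_le {d : ℕ} (hd : 1 ≤ d) (N : ℕ) {p : ℝ} (hp : 0 < p)
    (hp1 : p ≤ 1) (hlow : p * (d + N) ≤ d) (hhigh : (d : ℝ) < p * (d + (N + 1))) {C : ℝ}
    (hC : 0 ≤ C) :
    ∃ C' : ℝ, 0 < C' ∧ ∀ (y y₀ : Rd d) (ε R B D : ℝ), 0 < ε → ε ≤ R → 0 ≤ B → 0 ≤ D →
      ∫⁻ x, majorant N C y y₀ ε R B D x ^ p ≤ ENNReal.ofReal (C' * (ε ^ d * B ^ p)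
        + C' * max (R ^ ((d : ℝ) - p * d)) (R ^ ((d : ℝ) - p * (d + N)))
          * ((1 + Real.log (R / ε)) * D ^ p)) ∧
      (p * (d + N) < d → ∫⁻ x, majorant N C y y₀ ε R B D x ^ p ≤ ENNReal.ofReal
        (C' * (ε ^ d * B ^ p)
          + C' * max (R ^ ((d : ℝ) - p * d)) (R ^ ((d : ℝ) - p * (d + N))) * D ^ p)) := by
  obtain ⟨K₂, hK₂, h₂⟩ := exists_lintegral_shellPower_Ioi_rpow_le hd (d + (N + 1)) hp
    (by push_cast; exact hhigh)
  obtain ⟨K₃, hK₃, h₃⟩ := exists_lintegral_shellPower_Ioc_rpow_le_log hd (d + N) hp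
    (by push_cast; exact hlow)
  obtain ⟨K₄, hK₄, h₄⟩ : ∃ K : ℝ, 0 < K ∧ (p * (d + N) < d →
      ∀ (a : Rd d) (r s c : ℝ), 0 < r → 0 < s → 0 ≤ c →
      ∫⁻ x, shellPower (Set.Ioc r s) c (d + N) a x ^ p
        ≤ ENNReal.ofReal (K * (c ^ p * s ^ ((d : ℝ) - p * (d + N : ℕ))))) := by
    by_cases h : p * (d + N) < d
    · obtain ⟨K, hK, hle⟩ := exists_lintegral_shellPower_Ioc_rpow_le hd (d + N) hp
        (by push_cast; exact h)
      exact ⟨K, hK, fun _ => hle⟩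
    · exact ⟨1, one_pos, fun h' => absurd h' h⟩
  push_cast at h₂ h₃ h₄
  set V := volume.real (Metric.ball (0 : Rd d) 1) with hV
  have hV0 : 0 ≤ V := measureReal_nonneg
  set e := (d : ℝ) - p * (d + (N + 1)) with he
  set e' := (d : ℝ) - p * (d + N) with he'
  set P₁ := 2 ^ d * V * C ^ p with hP₁
  set P₂ := K₂ * C ^ p * 2 ^ e with hP₂
  set P₃ := K₃ * C ^ p * 4 ^ e' with hP₃
  set P₄ := K₄ * C ^ p * 4 ^ e' with hP₄
  have hP₁0 : 0 ≤ P₁ := by positivity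
  have hP₂0 : 0 ≤ P₂ := by positivity
  have hP₃0 : 0 ≤ P₃ := by positivity
  have hP₄0 : 0 ≤ P₄ := by positivity
  refine ⟨P₁ + P₂ + P₃ + P₄ + 1, by positivity, fun y y₀ ε R B D hε hεR hB hD => ?_⟩
  have hR : 0 < R := hε.trans_le hεR
  have hr : 0 < max 1 R := lt_max_of_lt_left one_pos
  have hlog : 0 ≤ Real.log (R / ε) := Real.log_nonneg (by rwa [le_div_iff₀ hε, one_mul])
  set m := max (R ^ ((d : ℝ) - p * d)) (R ^ e') with hm
  have hm0 : 0 ≤ m := le_max_of_le_right (by positivity)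
  have hmax : (max 1 R ^ N) ^ p * R ^ e' ≤ m := rpow_max_one_mul_rpow_le hR
  have hI₁ : ∫⁻ x, shellPower (Set.Iic (2 * ε)) (C * B) 0 y x ^ p
      ≤ ENNReal.ofReal (P₁ * (ε ^ d * B ^ p)) := by
    rw [lintegral_shellPower_Iic_rpow y hε (by positivity) hp, Real.mul_rpow hC hB]
    refine ENNReal.ofReal_le_ofReal (le_of_eq ?_)
    rw [hP₁]
    ring
  have hI₂ : ∫⁻ x, shellPower (Set.Ioi (2 * ε)) (C * (ε ^ (d + (N + 1)) * B)) (d + (N + 1)) y x ^ p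
      ≤ ENNReal.ofReal (P₂ * (ε ^ d * B ^ p)) := by
    refine (h₂ y (2 * ε) _ (by positivity) (by positivity)).trans
      (ENNReal.ofReal_le_ofReal (le_of_eq ?_))
    have hpow : (ε ^ (d + (N + 1))) ^ p * ε ^ e = ε ^ d := by
      rw [← Real.rpow_natCast, ← Real.rpow_mul hε.le, ← Real.rpow_add hε, ← Real.rpow_natCast]
      congr 1
      rw [he]
      push_cast
      ring
    rw [Real.mul_rpow hC (by positivity), Real.mul_rpow (by positivity) hB,
      Real.mul_rpow zero_le_two hε.le, hP₂, ← hpow]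
    ring
  have hI₄ : ∫⁻ x, shellPower (Set.Ioi (2 * R)) (C * (R * (max 1 R ^ N * D))) (d + (N + 1)) y₀ x ^ p
      ≤ ENNReal.ofReal (P₂ * (m * D ^ p)) := by
    refine (h₂ y₀ (2 * R) _ (by positivity) (by positivity)).trans (ENNReal.ofReal_le_ofReal ?_)
    have hpow : R ^ p * R ^ e = R ^ e' := by
      rw [← Real.rpow_add hR]
      congr 1
      rw [he, he']
      ring
    rw [Real.mul_rpow hC (by positivity), Real.mul_rpow hR.le (by positivity),
      Real.mul_rpow (by positivity) hD, Real.mul_rpow zero_le_two hR.le, hP₂]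
    calc _ = K₂ * C ^ p * 2 ^ e * ((max 1 R ^ N) ^ p * (R ^ p * R ^ e) * D ^ p) := by ring
      _ ≤ _ := by
        rw [hpow]
        gcongr
  have hI₃ : ∫⁻ x, shellPower (Set.Ioc (2 * ε) (4 * R)) (C * (max 1 R ^ N * D)) (d + N) y x ^ p
      ≤ ENNReal.ofReal (P₃ * (m * ((1 + Real.log (R / ε)) * D ^ p))) := by
    refine (h₃ y (2 * ε) (4 * R) _ (by positivity) (by linarith) (by positivity)).trans
      (ENNReal.ofReal_le_ofReal ?_)
    have hl : Real.log (4 * R / (2 * ε)) ≤ 1 + Real.log (R / ε) := by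
      have e2 : 4 * R / (2 * ε) = 2 * (R / ε) := by field_simp; ring
      rw [e2, Real.log_mul two_ne_zero (by positivity)]
      linarith [Real.log_two_lt_d9]
    rw [Real.mul_rpow hC (by positivity), Real.mul_rpow (by positivity) hD,
      Real.mul_rpow zero_le_four hR.le, hP₃]
    calc _ = K₃ * C ^ p * 4 ^ e' * ((max 1 R ^ N) ^ p * R ^ e'
          * (Real.log (4 * R / (2 * ε)) * D ^ p)) := by ring
      _ ≤ K₃ * C ^ p * 4 ^ e' * ((max 1 R ^ N) ^ p * R ^ e'
          * ((1 + Real.log (R / ε)) * D ^ p)) := by gcongr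
      _ ≤ _ := by gcongr
  have hI₃' : p * (d + N) < d →
      ∫⁻ x, shellPower (Set.Ioc (2 * ε) (4 * R)) (C * (max 1 R ^ N * D)) (d + N) y x ^ p
      ≤ ENNReal.ofReal (P₄ * (m * D ^ p)) := by
    intro h
    refine (h₄ h y (2 * ε) (4 * R) _ (by positivity) (by linarith) (by positivity)).trans
      (ENNReal.ofReal_le_ofReal ?_)
    rw [Real.mul_rpow hC (by positivity), Real.mul_rpow (by positivity) hD,
      Real.mul_rpow zero_le_four hR.le, hP₄]
    calc _ = K₄ * C ^ p * 4 ^ e' * ((max 1 R ^ N) ^ p * R ^ e' * D ^ p) := by ring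
      _ ≤ _ := by gcongr
  have hsplit := lintegral_majorant_rpow_le_add N C y y₀ ε R B D hp hp1
  set P := P₁ + P₂ + P₃ + P₄ + 1 with hP
  clear_value P₁ P₂ P₃ P₄ m
  set X := ε ^ d * B ^ p with hX
  have hX0 : 0 ≤ X := by positivity
  set T := m * D ^ p with hT
  have hT0 : 0 ≤ T := by positivity
  have hTL : T ≤ m * ((1 + Real.log (R / ε)) * D ^ p) := by
    rw [hT]
    gcongr
    exact le_mul_of_one_le_left (by positivity) (by linarith)
  set TL := m * ((1 + Real.log (R / ε)) * D ^ p) with hTLdef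
  have hTL0 : 0 ≤ TL := hT0.trans hTL
  refine ⟨?_, fun h => ?_⟩
  · refine (hsplit.trans (add_le_add (add_le_add (add_le_add hI₁ hI₂) hI₃) hI₄)).trans ?_
    rw [← ENNReal.ofReal_add (by positivity) (by positivity),
      ← ENNReal.ofReal_add (by positivity) (by positivity),
      ← ENNReal.ofReal_add (by positivity) (by positivity), mul_assoc _ m, ← hTLdef]
    refine ENNReal.ofReal_le_ofReal ?_
    have a := mul_le_mul_of_nonneg_right (show P₁ + P₂ ≤ P by linarith) hX0
    have b := mul_le_mul_of_nonneg_right (show P₃ + P₂ ≤ P by linarith) hTL0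
    have c := mul_le_mul_of_nonneg_left hTL hP₂0
    linarith
  · refine (hsplit.trans (add_le_add (add_le_add (add_le_add hI₁ hI₂) (hI₃' h)) hI₄)).trans ?_
    rw [← ENNReal.ofReal_add (by positivity) (by positivity),
      ← ENNReal.ofReal_add (by positivity) (by positivity),
      ← ENNReal.ofReal_add (by positivity) (by positivity), mul_assoc _ m, ← hT]
    refine ENNReal.ofReal_le_ofReal ?_
    have a := mul_le_mul_of_nonneg_right (show P₁ + P₂ ≤ P by linarith) hX0
    have b := mul_le_mul_of_nonneg_right (show P₄ + P₂ ≤ P by linarith) hT0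
    linarith

/-! ### The Hardy estimate for sums -/

theorem Lp_top_ae_norm_le {d : ℕ} (f : Lp ℂ ∞ (volume : Measure (Rd d))) :
    ∀ᵐ x, ‖f x‖ ≤ ‖f‖ := by
  have h := ae_le_lpNorm_exponent_top (Lp.memLp f)
  rwa [← toReal_eLpNorm (Lp.aestronglyMeasurable f), ← Lp.norm_def] at h

theorem radius_le_of_ball_subset_ball {d : ℕ} (hd : 1 ≤ d) {a b : Rd d} {r s : ℝ} (hr : 0 < r)
    (hs : 0 < s) (h : Metric.ball a r ⊆ Metric.ball b s) : r ≤ s := by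
  have : Nontrivial (Rd d) :=
    Module.nontrivial_of_finrank_pos (R := ℝ) (by rw [finrank_euclideanSpace_fin]; omega)
  have hdiam := Metric.diam_mono h Metric.isBounded_ball
  rw [Metric.diam_ball_eq _ hr.le, Metric.diam_ball_eq _ hs.le] at hdiam
  linarith

/-- The pointwise estimate. Far from the large ball, the vanishing moments of the sum allow one to
subtract from the kernel its Taylor polynomial at the centre `y₀`. -/
theorem exists_radialMaximal_le_sum_majorant {d : ℕ} (hd : 1 ≤ d) (N : ℕ) (Ψ : 𝓢(Rd d, ℂ))
    (hΨ : ∫ x, Ψ x ≠ 0) {p : ℝ} (hp : 0 < p) (hlow : p * (d + N) ≤ d) :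
    ∃ C : ℝ, 0 ≤ C ∧ ∀ (J : ℕ) (y : Fin J → Rd d) (ε : Fin J → ℝ)
      (f : Fin J → Lp ℂ ∞ (volume : Measure (Rd d))) (y₀ : Rd d) (R : ℝ),
      (∀ j, 0 < ε j) → 0 < R → (∀ j, ∀ᵐ x : Rd d, x ∉ Metric.ball (y j) (ε j) → f j x = 0) →
      (⋃ j, Metric.ball (y j) (ε j)) ⊆ Metric.ball y₀ R →
      Lp.toTemperedDistribution (∑ j, f j) ∈ hardySpace Ψ p → ∀ x,
      radialMaximal Ψ (Lp.toTemperedDistribution (∑ j, f j)) x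
        ≤ ∑ j, majorant N C (y j) y₀ (ε j) R ‖f j‖
          ((1 + ‖y₀‖ / max 1 R) ^ N * maxMoment N (f j)) x := by
  obtain ⟨C, hC, hmaj⟩ := exists_enorm_integral_le_majorant N Ψ
  refine ⟨C, hC, fun J y ε f y₀ R hε hR hsupp hsub hmem x => ?_⟩
  have hball : ∀ j, Metric.ball (y j) (ε j) ⊆ Metric.ball y₀ R := fun j =>
    (Set.subset_iUnion (fun j => Metric.ball (y j) (ε j)) j).trans hsub
  have hf : ∀ j, BoundedOnBall (f j) (y j) (ε j) ‖f j‖ := fun j =>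
    ⟨Lp.aestronglyMeasurable _, Lp_top_ae_norm_le _, hsupp j⟩
  have hεR : ∀ j, ε j ≤ R := fun j => radius_le_of_ball_subset_ball hd (hε j) hR (hball j)
  have hy : ∀ j, ‖y j - y₀‖ < R := fun j =>
    mem_ball_iff_norm.1 (hball j (Metric.mem_ball_self (hε j)))
  set F : Lp ℂ ∞ (volume : Measure (Rd d)) := ∑ j, f j with hF
  have hFsum : ∀ᵐ x, F x = ∑ j, f j x := Lp.coeFn_fun_finsetSum Finset.univ f
  have hFb : BoundedOnBall F y₀ R ‖F‖ := by
    refine ⟨Lp.aestronglyMeasurable _, Lp_top_ae_norm_le _, ?_⟩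
    filter_upwards [hFsum, ae_all_iff.2 hsupp] with z hz h hzR
    rw [hz]
    exact Finset.sum_eq_zero fun j _ => h j fun hj => hzR (hball j hj)
  have hsum : ∀ g : Rd d → ℂ, Continuous g → ∫ z, g z * F z = ∑ j, ∫ z, g z * f j z := by
    intro g hg
    rw [← integral_finsetSum _ fun j _ => (hf j).integrable_mul hg]
    refine integral_congr_ae ?_
    filter_upwards [hFsum] with z hz
    rw [hz, Finset.mul_sum]
  have hM : maxMoment N F = 0 := maxMoment_eq_zero fun α hα =>
    moment_eq_zero_of_mem_hardySpace hd Ψ hΨ hp hlow F hFb hR hmem α hα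
  refine iSup_le fun ζ => ?_
  rw [convDilated_toTemperedDistribution]
  set φ := dilatedKernel Ψ ζ x with hφ
  rcases lt_or_ge ‖x - y₀‖ (3 * R) with hx | hx
  · rw [hsum φ φ.continuous]
    exact (enorm_sum_le _ _).trans (Finset.sum_le_sum fun j _ =>
      (hmaj (f j) (y j) y₀ (ε j) R _ (hf j) (hε j) (hεR j) (hy j) ζ x).1 hx)
  · have hzero : ∑ j, ∫ z, taylorPoly N φ y₀ z * f j z = 0 := by
      rw [← hsum _ (continuous_taylorPoly N φ y₀), ← norm_le_zero_iff]
      refine (hFb.norm_integral_taylorPoly_le N φ y₀).trans (le_of_eq ?_)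
      simp [hM]
    rw [hsum φ φ.continuous, ← sub_zero (∑ j, ∫ z, φ z * f j z), ← hzero, ← Finset.sum_sub_distrib]
    exact (enorm_sum_le _ _).trans (Finset.sum_le_sum fun j _ =>
      (hmaj (f j) (y j) y₀ (ε j) R _ (hf j) (hε j) (hεR j) (hy j) ζ x).2 hx)

/-- A pointwise majorant of the maximal function by a sum passes to the Hardy quasinorm, because
`t ↦ t ^ p` is subadditive for `p ≤ 1`. -/
theorem hardyNorm_rpow_le_sum {d : ℕ} (Ψ : 𝓢(Rd d, ℂ)) {p : ℝ} (hp : 0 < p) (hp1 : p ≤ 1)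
    (T : 𝓢'(Rd d, ℂ)) {J : ℕ} (u : Fin J → Rd d → ℝ≥0∞) (hu : ∀ j, Measurable (u j))
    (h : ∀ x, radialMaximal Ψ T x ≤ ∑ j, u j x) {b : Fin J → ℝ} (hb : ∀ j, 0 ≤ b j)
    (hub : ∀ j, ∫⁻ x, u j x ^ p ≤ ENNReal.ofReal (b j)) :
    hardyNorm Ψ p T ^ p ≤ ENNReal.ofReal (∑ j, b j) := by
  rw [hardyNorm, ← ENNReal.rpow_mul, one_div, inv_mul_cancel₀ hp.ne', ENNReal.rpow_one,
    ENNReal.ofReal_sum_of_nonneg fun j _ => hb j]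
  calc ∫⁻ x, radialMaximal Ψ T x ^ p ≤ ∫⁻ x, ∑ j, u j x ^ p := lintegral_mono fun x =>
        (ENNReal.rpow_le_rpow (h x) hp.le).trans (ENNReal.rpow_sum_le_sum_rpow _ _ hp hp1)
    _ = ∑ j, ∫⁻ x, u j x ^ p := lintegral_finsetSum _ fun j _ => (hu j).pow_const p
    _ ≤ _ := Finset.sum_le_sum fun j _ => hub j

theorem mainTheorem4 (d : ℕ) (hd : 1 ≤ d)
    (Ψ : 𝓢(Rd d, ℂ)) (hΨ : ∫ x, Ψ x ≠ 0)
    (p : ℝ) (hp0 : 0 < p) (hp1 : p ≤ 1)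
    (N : ℕ) (hN : IsGreatest {n : ℕ | (n : ℝ) ≤ d * (1 / p - 1)} N) :
    ∃ C : ℝ, 0 < C ∧
      ∀ (J : ℕ) (y : Fin J → Rd d) (ε : Fin J → ℝ) (f : Fin J → Lp ℂ ∞ (volume : Measure (Rd d)))
        (y₀ : Rd d) (R : ℝ),
        (∀ j, 0 < ε j) → 0 < R →
        (∀ j, ∀ᵐ x : Rd d, x ∉ Metric.ball (y j) (ε j) → f j x = 0) →
        (⋃ j, Metric.ball (y j) (ε j)) ⊆ Metric.ball y₀ R →
        Lp.toTemperedDistribution (∑ j, f j) ∈ hardySpace Ψ p →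
        (hardyNorm Ψ p (Lp.toTemperedDistribution (∑ j, f j)) ^ p ≤ ENNReal.ofReal
          (C * ∑ j, (ε j ^ d * ‖f j‖ ^ p
              + ε j ^ ((d : ℝ) - p * (d + N)) * max (R ^ (N * p)) 1
                * ((1 + ‖y₀‖ / max 1 R) ^ N * maxMoment N (f j)) ^ p)
            + C * max (R ^ ((d : ℝ) - p * d)) (R ^ ((d : ℝ) - p * (d + N)))
              * ∑ j, (1 + Real.log (R / ε j))
                * ((1 + ‖y₀‖ / max 1 R) ^ N * maxMoment N (f j)) ^ p)) ∧
        ((∀ k : ℕ, (d : ℝ) / p ≠ k) →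
          hardyNorm Ψ p (Lp.toTemperedDistribution (∑ j, f j)) ^ p ≤ ENNReal.ofReal
          (C * ∑ j, (ε j ^ d * ‖f j‖ ^ p
              + ε j ^ ((d : ℝ) - p * (d + N)) * max (R ^ (N * p)) 1
                * ((1 + ‖y₀‖ / max 1 R) ^ N * maxMoment N (f j)) ^ p)
            + C * max (R ^ ((d : ℝ) - p * d)) (R ^ ((d : ℝ) - p * (d + N)))
              * ∑ j, ((1 + ‖y₀‖ / max 1 R) ^ N * maxMoment N (f j)) ^ p)) := by
  have hlow : p * (d + N) ≤ d := by
    have h : (N : ℝ) ≤ d * (1 / p - 1) := hN.1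
    have h2 := mul_le_mul_of_nonneg_left h hp0.le
    have e : p * (d * (1 / p - 1)) = d - p * d := by field_simp
    linarith
  have hhigh : (d : ℝ) < p * (d + (N + 1)) := by
    have h : ¬ ((N + 1 : ℕ) : ℝ) ≤ d * (1 / p - 1) := fun h => absurd (hN.2 h) (by omega)
    have h2 := mul_lt_mul_of_pos_left (not_le.1 h) hp0
    have e : p * (d * (1 / p - 1)) = d - p * d := by field_simp
    push_cast at h2
    linarith
  obtain ⟨C₀, hC₀, hpt⟩ := exists_radialMaximal_le_sum_majorant hd N Ψ hΨ hp0 hlow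
  obtain ⟨C, hC, hint⟩ := exists_lintegral_majorant_rpow_le hd N hp0 hp1 hlow hhigh hC₀
  refine ⟨C, hC, fun J y ε f y₀ R hε hR hsupp hsub hmem => ?_⟩
  have hball : ∀ j, Metric.ball (y j) (ε j) ⊆ Metric.ball y₀ R := fun j =>
    (Set.subset_iUnion (fun j => Metric.ball (y j) (ε j)) j).trans hsub
  have hεR : ∀ j, ε j ≤ R := fun j => radius_le_of_ball_subset_ball hd (hε j) hR (hball j)
  set D : Fin J → ℝ := fun j => (1 + ‖y₀‖ / max 1 R) ^ N * maxMoment N (f j) with hD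
  have hr : 0 < max 1 R := lt_max_of_lt_left one_pos
  have hD0 : ∀ j, 0 ≤ D j := fun j => mul_nonneg (by positivity) (maxMoment_nonneg N _)
  set m := max (R ^ ((d : ℝ) - p * d)) (R ^ ((d : ℝ) - p * (d + N))) with hm
  have hm0 : 0 ≤ m := le_max_of_le_right (by positivity)
  have hpt' := hpt J y ε f y₀ R hε hR hsupp hsub hmem
  -- The summand with `ε j ^ (d - p (d + N))` only enlarges the bound.
  have hextra : ∀ j, 0 ≤ ε j ^ ((d : ℝ) - p * (d + N)) * max (R ^ (N * p)) 1 * D j ^ p := by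
    intro j
    have h1 := hε j
    have h2 := hD0 j
    have h3 : (0 : ℝ) ≤ max (R ^ (N * p)) 1 := le_max_of_le_right zero_le_one
    positivity
  have hmain : ∀ L : Fin J → ℝ, (∀ j, 0 ≤ L j) →
      (∀ j, ∫⁻ x, majorant N C₀ (y j) y₀ (ε j) R ‖f j‖ (D j) x ^ p
        ≤ ENNReal.ofReal (C * (ε j ^ d * ‖f j‖ ^ p) + C * m * L j)) →
      hardyNorm Ψ p (Lp.toTemperedDistribution (∑ j, f j)) ^ p ≤ ENNReal.ofReal
        (C * ∑ j, (ε j ^ d * ‖f j‖ ^ p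
          + ε j ^ ((d : ℝ) - p * (d + N)) * max (R ^ (N * p)) 1 * D j ^ p) + C * m * ∑ j, L j) := by
    intro L hL h
    refine (hardyNorm_rpow_le_sum Ψ hp0 hp1 _ _ (fun j => measurable_majorant _ _ _ _ _ _ _ _) hpt'
      (fun j => ?_) h).trans (ENNReal.ofReal_le_ofReal ?_)
    · have h1 := hε j
      have h2 := hL j
      positivity
    · rw [Finset.sum_add_distrib, ← Finset.mul_sum, ← Finset.mul_sum]
      gcongr with j
      exact le_add_of_nonneg_right (hextra j)
  refine ⟨hmain (fun j => (1 + Real.log (R / ε j)) * D j ^ p) (fun j => ?_) (fun j => ?_),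
    fun hk => hmain (fun j => D j ^ p) (fun j => ?_) (fun j => ?_)⟩
  · have h1 : 0 ≤ Real.log (R / ε j) :=
      Real.log_nonneg (by rw [le_div_iff₀ (hε j), one_mul]; exact hεR j)
    have h2 := hD0 j
    positivity
  · exact (hint (y j) y₀ (ε j) R ‖f j‖ (D j) (hε j) (hεR j) (norm_nonneg _) (hD0 j)).1
  · have h2 := hD0 j
    positivity
  · refine (hint (y j) y₀ (ε j) R ‖f j‖ (D j) (hε j) (hεR j) (norm_nonneg _) (hD0 j)).2 ?_
    -- Equality would make `d / p = d + N` an integer.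
    refine lt_of_le_of_ne hlow fun heq => hk (d + N) ?_
    rw [div_eq_iff hp0.ne']
    push_cast
    linarith
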